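/- Let $G=\operatorname{SL}_3(\mathbb R)$, $\Gamma=\operatorname{SL}_3(\mathbb Z)$, let $X=\Gamma\backslash G$ be the space of cosets $\Gamma g$ with the quotient topology and its Borel $\sigma$-algebra, let $\alpha=\operatorname{diag}(e^{1/2},e^{1/2},e^{-1})\in G$, and let $T:X\to X$ be the map $T(\Gamma g)=\Gamma g\alpha$. For a $T$-invariant Borel probability measure $\mu$ on $X$ let $h_\mu(T)\in[0,\infty]$ denote the measure-theoretic (Kolmogorov–Sinai) entropy, defined with the natural logarithm. Let $c\in\mathbb R$ and let $(\mu_i)_{i\ge 1}$ be a sequence of $T$-invariant Borel probability measures on $X$ with $h_{\mu_i}(T)\ge c$ for all $i$. Then every weak$^*$ limit $\mu$ of the sequence satisfies $$\mu(X)\ \ge\ c-2 .$$ Here a Borel measure $\mu$ on $X$ that is finite on compact sets is called a weak$^*$ limit of $(\mu_i)$ if there is a subsequence $(\mu_{i_k})_{k\ge 1}$ such that $\lim_{k\to\infty}\int_X f\,d\mu_{i_k}=\int_X f\,d\mu$ for every continuous compactly supported $f:X\to\mathbb R$. -/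

import Mathlib

open MeasureTheory Filter Topology

namespace EscapeOfMass

/-! ### Measure-theoretic (Kolmogorov–Sinai) entropy -/

section Entropy

variable {Ω : Type*} [MeasurableSpace Ω]

/-- The (static) entropy `H_μ(ξ) = -∑ μ(P) log μ(P)`, with the natural logarithm, of the finite
partition of `Ω` into the fibres of a labelling `ξ`. Since `Real.negMulLog 0 = 0`, empty fibres and
null fibres do not contribute. -/
noncomputable def partitionEntropy {ι : Type*} [Fintype ι] (μ : Measure Ω) (ξ : Ω → ι) : ℝ :=
  ∑ i, Real.negMulLog (μ.real (ξ ⁻¹' {i}))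

/-- The labelling of the refined partition `ξ ∨ T⁻¹ ξ ∨ ⋯ ∨ T⁻⁽ⁿ⁻¹⁾ ξ`: the label of `x` is the word
`(ξ x, ξ (T x), …, ξ (Tⁿ⁻¹ x))`. -/
def itinerary {ι : Type*} (T : Ω → Ω) (ξ : Ω → ι) (n : ℕ) : Ω → (Fin n → ι) :=
  fun x j => ξ (T^[j] x)

/-- The entropy `h_μ(T, ξ) = lim_n H_μ(ξ ∨ T⁻¹ ξ ∨ ⋯ ∨ T⁻⁽ⁿ⁻¹⁾ ξ) / n` of `T` with respect to a finite
partition. For an invariant probability measure the limit exists by subadditivity, so that writing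
it as an upper limit makes no difference. -/
noncomputable def entropyOfPartition {ι : Type*} [Fintype ι]
    (T : Ω → Ω) (μ : Measure Ω) (ξ : Ω → ι) : EReal :=
  limsup (fun n : ℕ => ((partitionEntropy μ (itinerary T ξ n) / n : ℝ) : EReal)) atTop

/-- The measure-theoretic entropy `h_μ(T)`: the supremum of `h_μ(T, ξ)` over all finite measurable
partitions `ξ`; it may be `+∞`. -/
noncomputable def entropy (T : Ω → Ω) (μ : Measure Ω) : EReal :=
  ⨆ (k : ℕ) (ξ : Ω → Fin k) (_ : Measurable ξ), entropyOfPartition T μ ξ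

end Entropy

/-! ### The space `SL₃(ℤ) \ SL₃(ℝ)` -/

/-- The group `SL₃(ℝ)`. -/
abbrev G : Type := Matrix.SpecialLinearGroup (Fin 3) ℝ

/-- The subgroup `SL₃(ℤ)` of `SL₃(ℝ)`. -/
def Γ : Subgroup G := (Matrix.SpecialLinearGroup.map (Int.castRingHom ℝ)).range

/-- The space `X = SL₃(ℤ) \ SL₃(ℝ)` of cosets `Γ g`, for `g` in `SL₃(ℝ)`. -/
def X : Type := Quotient (QuotientGroup.rightRel Γ)

/-- The quotient topology. -/
instance : TopologicalSpace X :=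
  inferInstanceAs (TopologicalSpace (Quotient (QuotientGroup.rightRel Γ)))

/-- The Borel `σ`-algebra of the quotient topology. -/
instance : MeasurableSpace X := borel X

instance : BorelSpace X := ⟨rfl⟩

/-- The diagonal matrix `α = diag(e^{1/2}, e^{1/2}, e^{-1})`. -/
noncomputable def α : G :=
  ⟨Matrix.diagonal ![Real.exp (1 / 2), Real.exp (1 / 2), Real.exp (-1)], by
    rw [Matrix.det_diagonal, Fin.prod_univ_three]
    simp only [Matrix.cons_val_zero, Matrix.cons_val_one, Matrix.cons_val]
    rw [← Real.exp_add, ← Real.exp_add]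
    norm_num⟩

/-- The map `T : X → X`, `T (Γ g) = Γ g α`. -/
noncomputable def T : X → X :=
  Quotient.map (fun g : G => g * α) (by
    intro g h hgh
    change QuotientGroup.rightRel Γ _ _
    have hgh' : QuotientGroup.rightRel Γ g h := hgh
    rw [QuotientGroup.rightRel_apply] at hgh' ⊢
    simpa [mul_assoc] using hgh')

/-! ### Weak* limits -/

/-- `ν` is a weak* limit of the sequence `μ` of measures: `ν` is a Borel measure that is finite on
compact sets, and there is a subsequence of `μ` along which the integral of every continuous real
function with compact support converges to its integral against `ν`. The total mass may drop. -/
def IsWeakStarLimit {Y : Type*} [TopologicalSpace Y] [MeasurableSpace Y]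
    (μ : ℕ → Measure Y) (ν : Measure Y) : Prop :=
  IsFiniteMeasureOnCompacts ν ∧
    ∃ φ : ℕ → ℕ, StrictMono φ ∧
      ∀ f : Y → ℝ, Continuous f → HasCompactSupport f →
        Tendsto (fun k => ∫ x, f x ∂(μ (φ k))) atTop (𝓝 (∫ x, f x ∂ν))

end EscapeOfMass

/-! Everything rests on a bound uniform in the measure: for each `ε` there is one compact `K` with
h_μ(T) ≤ 2 + 3ε + μ(K) for all invariant probability measures (`exists_compact_entropy_le`). Testing
against a compactly supported function that is 1 on `K` and at most 1 elsewhere carries the bound to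
weak* limits.

The constant 2 is 3 - 1. Conjugation by `α` expands a two-dimensional horospherical group at rate
3/2 in each direction. A block of `t` units of an orbit is thus described by one of about e^{3t}
grid displacements, and this plain code costs 3 per unit time. In the cusp the code can be made
cheaper by 1 per unit time, because trajectories that stay high are rare: a height function `φ`
drops by a factor of about e^{-t} on average under a random step of the walk x ↦ x u α^t. Give a
step the weight φ(new)/φ(old), suitably normalised (a Doob transform). The weights of words form a
subprobability (`sum_walkWeight_le`), the ratios telescope, and each block spent outside `K` saves
nearly `t` (`neg_log_walkWeight_le`). Gibbs' inequality `partitionEntropy_le_integral` bounds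
entropy by mean code length, here about 3 - (1 - μ(K)); this is `entropy_le_of_walk`.

The height is systole^{-2} plus a large multiple of (dual systole)^{-1}. The exponents 2 and 1 are
those for which both averages contract by e^{-t} up to logarithms (`sum_inv_sq_norm_le`,
`sum_inv_norm_dual_le`). `systole_dichotomy` passes from single vectors to lattices: either one
short vector controls the systole after every step, or two independent short vectors make the dual
lattice short, and the other summand of the height takes over. Low height means compactness by
Mahler's criterion, `exists_bounded_representative`. -/

namespace EscapeOfMass

/-! ### Gibbs' inequality and codes with errors. -/

section Gibbs

lemma negMulLog_le_of_pos {p q : ℝ} (hp : 0 ≤ p) (hq : 0 < q) :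
    Real.negMulLog p ≤ p * (-Real.log q) + (q - p) := by
  rcases hp.eq_or_lt with rfl | hp
  · simpa using hq.le
  · have h := Real.log_le_sub_one_of_pos (div_pos hq hp)
    rw [Real.log_div hq.ne' hp.ne'] at h
    have h2 := mul_le_mul_of_nonneg_left h hp.le
    have h3 : p * (q / p - 1) = q - p := by field_simp
    rw [Real.negMulLog]
    linarith

variable {Ω : Type*} [MeasurableSpace Ω]

lemma measurable_itinerary {ι : Type*} [MeasurableSpace ι] {T : Ω → Ω} {ξ : Ω → ι}
    (hT : Measurable T) (hξ : Measurable ξ) (n : ℕ) : Measurable (itinerary T ξ n) :=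
  measurable_pi_lambda _ fun j => hξ.comp (hT.iterate j)

/-- Gibbs' inequality: the entropy of a partition is at most the mean code length for any
subprobability vector `q` on its labels. -/
lemma partitionEntropy_le_integral {ι : Type*} [Fintype ι] [MeasurableSpace ι]
    [MeasurableSingletonClass ι] {μ : Measure Ω} [IsProbabilityMeasure μ] {ζ : Ω → ι}
    (hζ : Measurable ζ) {q : ι → ℝ} (hq : ∀ i, 0 < q i) (hsum : ∑ i, q i ≤ 1)
    {h : Ω → ℝ} (hh : Integrable h μ) (hle : ∀ x, -Real.log (q (ζ x)) ≤ h x) :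
    partitionEntropy μ ζ ≤ ∫ x, h x ∂μ := by
  have : IsProbabilityMeasure (μ.map ζ) := Measure.isProbabilityMeasure_map hζ.aemeasurable
  have hmap : ∀ i, (μ.map ζ).real {i} = μ.real (ζ ⁻¹' {i}) := fun i =>
    map_measureReal_apply hζ (measurableSet_singleton i)
  have hone : ∑ i, μ.real (ζ ⁻¹' {i}) = 1 := by
    simp_rw [← hmap]
    rw [sum_measureReal_singleton]
    simp
  have hint : ∫ x, -Real.log (q (ζ x)) ∂μ = ∑ i, μ.real (ζ ⁻¹' {i}) * (-Real.log (q i)) := by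
    rw [← integral_map (f := fun i => -Real.log (q i)) hζ.aemeasurable
      (Measurable.of_discrete).aestronglyMeasurable, integral_fintype .of_finite]
    simp [hmap]
  calc partitionEntropy μ ζ
      ≤ ∑ i, (μ.real (ζ ⁻¹' {i}) * (-Real.log (q i)) + (q i - μ.real (ζ ⁻¹' {i}))) :=
        Finset.sum_le_sum fun i _ => negMulLog_le_of_pos measureReal_nonneg (hq i)
    _ ≤ ∫ x, -Real.log (q (ζ x)) ∂μ := by
        rw [Finset.sum_add_distrib, Finset.sum_sub_distrib, hone, hint]
        linarith
    _ ≤ ∫ x, h x ∂μ := by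
        refine integral_mono ?_ hh hle
        exact Integrable.comp_measurable (f := ζ) (g := fun i => -Real.log (q i))
          (Integrable.of_finite) hζ

lemma entropyOfPartition_le {ι : Type*} [Fintype ι] {T : Ω → Ω} {μ : Measure Ω} {ξ : Ω → ι}
    {A B : ℝ} (h : ∀ n : ℕ, partitionEntropy μ (itinerary T ξ n) ≤ A + n * B) :
    entropyOfPartition T μ ξ ≤ (B : EReal) := by
  have hlim : Tendsto (fun n : ℕ => ((A / n + B : ℝ) : EReal)) atTop (𝓝 ((0 + B : ℝ) : EReal)) :=
    (continuous_coe_real_ereal.tendsto _).comp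
      ((tendsto_const_div_atTop_nhds_zero_nat A).add tendsto_const_nhds)
  rw [zero_add] at hlim
  rw [← hlim.limsup_eq]
  refine limsup_le_limsup ?_ (by isBoundedDefault) (by isBoundedDefault)
  filter_upwards [eventually_gt_atTop 0] with n hn
  have hn' : (0 : ℝ) < n := by exact_mod_cast hn
  rw [EReal.coe_le_coe_iff, div_le_iff₀ hn', add_mul, div_mul_cancel₀ _ hn'.ne']
  linarith [h n]

/-- The noisy channel: a guess is kept with weight `1 - e` and replaced by a uniform letter with
weight `e`. -/
noncomputable def channel (k : ℕ) (e : ℝ) (b a : Fin k) : ℝ :=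
  (if a = b then 1 - e else 0) + e / k

lemma sum_channel {k : ℕ} (e : ℝ) (b : Fin k) : ∑ a, channel k e b a = 1 := by
  have hk : (k : ℝ) ≠ 0 := by
    have := b.pos
    positivity
  simp [channel, Finset.sum_add_distrib]
  field_simp
  ring

lemma channel_pos {k : ℕ} {e : ℝ} (he : 0 < e) (he1 : e < 1) (b a : Fin k) :
    0 < channel k e b a := by
  have hk : (0 : ℝ) < k := by exact_mod_cast b.pos
  have h2 : 0 < e / k := by positivity
  unfold channel
  split_ifs <;> linarith

/-- Mixture of a code with weights `Q` and noisy guesses `g`, and of the uniform distribution. -/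
noncomputable def mixture {C : Type*} [Fintype C] {k n : ℕ} (e : ℝ) (Q : C → ℝ)
    (g : C → Fin n → Fin k) (w : Fin n → Fin k) : ℝ :=
  1 / 2 * ((k : ℝ) ^ n)⁻¹ + 1 / 2 * ∑ c, Q c * ∏ j, channel k e (g c j) (w j)

variable {C : Type*} [Fintype C] {k n : ℕ} {e : ℝ} {Q : C → ℝ} (g : C → Fin n → Fin k)

lemma sum_mixture_le (hk : 0 < k) (hQ : ∑ c, Q c ≤ 1) :
    ∑ w, mixture e Q g w ≤ 1 := by
  have hk' : (k : ℝ) ≠ 0 := by positivity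
  have h1 : ∑ w : Fin n → Fin k, ∑ c, Q c * ∏ j, channel k e (g c j) (w j) = ∑ c, Q c := by
    rw [Finset.sum_comm]
    refine Finset.sum_congr rfl fun c _ => ?_
    rw [← Finset.mul_sum, ← Fintype.prod_sum (fun j a => channel k e (g c j) a)]
    simp [sum_channel]
  simp only [mixture]
  rw [Finset.sum_add_distrib, ← Finset.mul_sum, ← Finset.mul_sum, h1]
  simp only [Finset.sum_const, Finset.card_univ, Fintype.card_fun, Fintype.card_fin,
    nsmul_eq_mul, Nat.cast_pow]
  rw [mul_inv_cancel₀ (pow_ne_zero _ hk')]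
  linarith

lemma mixture_pos (hk : 0 < k) (he : 0 < e) (he1 : e < 1) (hQ0 : ∀ c, 0 ≤ Q c)
    (w : Fin n → Fin k) : 0 < mixture e Q g w := by
  have hk' : (0 : ℝ) < k := by exact_mod_cast hk
  have h2 : 0 ≤ ∑ c, Q c * ∏ j, channel k e (g c j) (w j) :=
    Finset.sum_nonneg fun c _ => mul_nonneg (hQ0 c)
      (Finset.prod_nonneg fun j _ => (channel_pos he he1 _ _).le)
  unfold mixture
  positivity

/-- The uniform half of the mixture serves points without a code word. Its cost per letter is large,
but it will be paid only on a set of small measure. -/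
lemma neg_log_mixture_le_uniform (hk : 0 < k) (he : 0 < e) (he1 : e < 1) (hQ0 : ∀ c, 0 ≤ Q c)
    (w : Fin n → Fin k) : -Real.log (mixture e Q g w) ≤ Real.log 2 + n * Real.log k := by
  have hk' : (0 : ℝ) < k := by exact_mod_cast hk
  have h2 : 0 ≤ ∑ c, Q c * ∏ j, channel k e (g c j) (w j) :=
    Finset.sum_nonneg fun c _ => mul_nonneg (hQ0 c)
      (Finset.prod_nonneg fun j _ => (channel_pos he he1 _ _).le)
  have h3 : (2 * (k : ℝ) ^ n)⁻¹ ≤ mixture e Q g w := by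
    unfold mixture
    rw [mul_inv]
    linarith
  have h4 := Real.log_le_log (by positivity) h3
  rw [Real.log_inv, Real.log_mul (by norm_num) (by positivity), Real.log_pow] at h4
  linarith

-- Keep the single term `c` of the mixture. A code word then need only predict most of the
-- itinerary: each wrong guess costs `log k - log e`, and each letter costs the small amount `-log
-- (1 - e)`.
open Classical in
lemma neg_log_mixture_le (hk : 0 < k) (he : 0 < e) (he1 : e < 1) (hQ0 : ∀ c, 0 ≤ Q c)
    (w : Fin n → Fin k) {c : C} (hc : 0 < Q c) :
    -Real.log (mixture e Q g w) ≤ Real.log 2 - Real.log (Q c) +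
      (n * (-Real.log (1 - e)) + (Real.log k - Real.log e) *
        ∑ j, if w j = g c j then 0 else 1) := by
  have hk' : (0 : ℝ) < k := by exact_mod_cast hk
  have hk1 : (1 : ℝ) ≤ k := by exact_mod_cast hk
  have hpos : 0 < ∏ j, channel k e (g c j) (w j) :=
    Finset.prod_pos fun j _ => channel_pos he he1 _ _
  have h1 : Q c * ∏ j, channel k e (g c j) (w j) ≤
      ∑ c, Q c * ∏ j, channel k e (g c j) (w j) :=
    Finset.single_le_sum (f := fun c => Q c * ∏ j, channel k e (g c j) (w j))
      (fun c _ => mul_nonneg (hQ0 c) (Finset.prod_nonneg fun j _ => (channel_pos he he1 _ _).le))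
      (Finset.mem_univ c)
  have h3 : 2⁻¹ * (Q c * ∏ j, channel k e (g c j) (w j)) ≤ mixture e Q g w := by
    unfold mixture
    have : 0 < ((k : ℝ) ^ n)⁻¹ := by positivity
    linarith
  have h4 := Real.log_le_log (by positivity) h3
  rw [Real.log_mul (by norm_num) (by positivity), Real.log_mul hc.ne' hpos.ne', Real.log_inv,
    Real.log_prod (fun j _ => (channel_pos he he1 _ _).ne')] at h4
  have h5 : ∀ j, -Real.log (channel k e (g c j) (w j)) ≤
      -Real.log (1 - e) + (Real.log k - Real.log e) * (if w j = g c j then 0 else 1) := by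
    intro j
    have he0 : 0 ≤ e / k := by positivity
    unfold channel
    split_ifs with hj
    · have := Real.log_le_log (by linarith) (show 1 - e ≤ 1 - e + e / k by linarith)
      simpa using this
    · rw [zero_add, Real.log_div he.ne' hk'.ne']
      have := Real.log_nonpos (show 0 ≤ 1 - e by linarith) (by linarith)
      linarith
  have h6 := Finset.sum_le_sum fun j (_ : j ∈ Finset.univ) => h5 j
  rw [Finset.sum_neg_distrib, Finset.sum_add_distrib, ← Finset.mul_sum] at h6
  simp only [Finset.sum_const, Finset.card_univ, Fintype.card_fin, nsmul_eq_mul] at h6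
  linarith

end Gibbs

/-! ### Topology of the quotient and right translations. -/

section SpaceTopology

instance : DiscreteTopology Γ :=
  inferInstanceAs (DiscreteTopology (Matrix.SpecialLinearGroup.map (Int.castRingHom ℝ)).range)

instance : LocallyCompactSpace G := by
  have : IsClosed {M : Matrix (Fin 3) (Fin 3) ℝ | M.det = 1} :=
    isClosed_eq (continuous_id.matrix_det) continuous_const
  have : LocallyCompactSpace (Matrix (Fin 3) (Fin 3) ℝ) :=
    inferInstanceAs (LocallyCompactSpace (Fin 3 → Fin 3 → ℝ))
  exact (Topology.IsClosedEmbedding.subtypeVal ‹IsClosed _› : Topology.IsClosedEmbedding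
    (Subtype.val : G → Matrix (Fin 3) (Fin 3) ℝ)).locallyCompactSpace

instance : SecondCountableTopology G :=
  have : SecondCountableTopology (Matrix (Fin 3) (Fin 3) ℝ) :=
    inferInstanceAs (SecondCountableTopology (Fin 3 → Fin 3 → ℝ))
  (Topology.IsEmbedding.subtypeVal : Topology.IsEmbedding
    (Subtype.val : G → Matrix (Fin 3) (Fin 3) ℝ)).secondCountableTopology

instance : ProperlyDiscontinuousSMul Γ G :=
  Subgroup.properlyDiscontinuousSMul_of_tendsto_cofinite Γ
    (Subgroup.tendsto_coe_cofinite_of_discrete Γ ⟨inferInstanceAs (DiscreteTopology Γ)⟩)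

/-- The projection `g ↦ Γ g`. -/
def proj (g : G) : X := Quotient.mk (QuotientGroup.rightRel Γ) g

lemma isOpenQuotientMap_proj : IsOpenQuotientMap proj :=
  (MulAction.isOpenQuotientMap_quotientMk :
    IsOpenQuotientMap (Quotient.mk (MulAction.orbitRel Γ G)))

instance : T2Space X :=
  inferInstanceAs (T2Space (Quotient (MulAction.orbitRel Γ G)))

instance : SecondCountableTopology X :=
  (ContinuousConstSMul.secondCountableTopology :
    SecondCountableTopology (Quotient (MulAction.orbitRel Γ G)))

instance : LocallyCompactSpace X := isOpenQuotientMap_proj.locallyCompactSpace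

instance : TopologicalSpace.MetrizableSpace X :=
  TopologicalSpace.metrizableSpace_of_t3_secondCountable X

lemma proj_eq_proj_iff {g h : G} : proj g = proj h ↔ ∃ γ ∈ Γ, γ * g = h := by
  have : proj g = proj h ↔ QuotientGroup.rightRel Γ g h := Quotient.eq
  rw [this, QuotientGroup.rightRel_apply]
  exact ⟨fun H => ⟨_, H, by group⟩, by rintro ⟨γ, hγ, rfl⟩; simpa using hγ⟩

/-- The right translation `Γ g ↦ Γ g h`. -/
def translate (x : X) (h : G) : X :=
  Quotient.liftOn x (fun g => proj (g * h)) fun a b hab => by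
    have hab' : proj a = proj b := Quotient.sound hab
    obtain ⟨γ, hγ, rfl⟩ := proj_eq_proj_iff.1 hab'
    exact proj_eq_proj_iff.2 ⟨γ, hγ, (mul_assoc _ _ _).symm⟩

@[simp] lemma translate_proj (g h : G) : translate (proj g) h = proj (g * h) := rfl

lemma continuous_translate : Continuous fun p : X × G => translate p.1 p.2 :=
  (isOpenQuotientMap_proj.prodMap IsOpenQuotientMap.id).continuous_comp_iff.1
    (isOpenQuotientMap_proj.continuous.comp continuous_mul)

@[simp] lemma T_proj (g : G) : T (proj g) = proj (g * α) := rfl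

lemma iterate_T_proj (n : ℕ) (g : G) : T^[n] (proj g) = proj (g * α ^ n) := by
  induction n with
  | zero => simp
  | succ n ih => rw [Function.iterate_succ_apply', ih, T_proj, mul_assoc, ← pow_succ]

lemma continuous_T : Continuous T :=
  isOpenQuotientMap_proj.continuous_comp_iff.1
    (isOpenQuotientMap_proj.continuous.comp (continuous_mul_const α))

/-- Finitely many disjoint compact sets are separated by a neighbourhood of the identity acting by
right translations. -/
lemma exists_nhds_one_separating {ι : Type*} [Finite ι] {K : ι → Set X}
    (hK : ∀ i, IsCompact (K i)) (hdisj : Pairwise (Function.onFun Disjoint K)) :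
    ∃ W ∈ 𝓝 (1 : G), ∀ i j x, ∀ h ∈ W, x ∈ K i → translate x h ∈ K j → i = j := by
  have key : ∀ i j, i ≠ j → ∃ W ∈ 𝓝 (1 : G), ∀ x ∈ K i, ∀ h ∈ W, translate x h ∉ K j := by
    intro i j hij
    have hopen : IsOpen ((fun p : X × G => translate p.1 p.2) ⁻¹' (K j)ᶜ) :=
      (hK j).isClosed.isOpen_compl.preimage continuous_translate
    obtain ⟨U, V, -, hV, hU', hV', hUV⟩ := generalized_tube_lemma (hK i)
      (isCompact_singleton (x := (1 : G))) hopen (by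
        rintro ⟨x, h⟩ ⟨hx, rfl : h = 1⟩
        have : translate x 1 = x := by
          obtain ⟨g, rfl⟩ := isOpenQuotientMap_proj.surjective x
          simp
        simpa [this] using Set.disjoint_left.1 (hdisj hij) hx)
    exact ⟨V, hV.mem_nhds (hV' rfl), fun x hx h hh => hUV (Set.mk_mem_prod (hU' hx) hh)⟩
  choose! W hW hW' using key
  refine ⟨⋂ i, ⋂ j, ⋂ _ : i ≠ j, W i j, ?_, ?_⟩
  · refine Filter.iInter_mem.2 fun i => Filter.iInter_mem.2 fun j => Filter.iInter_mem.2 fun h => hW i j h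
  · intro i j x h hh hx hx'
    by_contra hij
    exact hW' i j hij x hx h (by simp only [Set.mem_iInter] at hh; exact hh i j hij) hx'

end SpaceTopology

/-! ### The expanded horospherical group and the complementary parabolic group. -/

section Group

/-- The lower unipotent element with bottom row `(v.1, v.2, 1)`; these elements form the horospherical
subgroup expanded by `α`. -/
def unip (v : ℝ × ℝ) : G :=
  ⟨!![1, 0, 0; 0, 1, 0; v.1, v.2, 1], by simp [Matrix.det_fin_three]⟩

lemma coe_unip (v : ℝ × ℝ) : (unip v : Matrix (Fin 3) (Fin 3) ℝ) =
    !![1, 0, 0; 0, 1, 0; v.1, v.2, 1] := rfl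

lemma unip_mul (v w : ℝ × ℝ) : unip v * unip w = unip (v + w) := by
  apply Subtype.ext
  rw [Matrix.SpecialLinearGroup.coe_mul, coe_unip, coe_unip, coe_unip]
  ext i j
  fin_cases i <;> fin_cases j <;> simp [Matrix.mul_apply, Fin.sum_univ_three]

lemma unip_zero : unip 0 = 1 := by
  apply Subtype.ext
  rw [coe_unip, Matrix.SpecialLinearGroup.coe_one]
  ext i j
  fin_cases i <;> fin_cases j <;> simp

lemma inv_unip (v : ℝ × ℝ) : (unip v)⁻¹ = unip (-v) := by
  rw [inv_eq_iff_mul_eq_one, unip_mul, add_neg_cancel, unip_zero]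

/-- The exponents of `α`. -/
noncomputable def weight : Fin 3 → ℝ := ![1 / 2, 1 / 2, -1]

lemma coe_α_pow (n : ℕ) : ((α ^ n : G) : Matrix (Fin 3) (Fin 3) ℝ) =
    Matrix.diagonal fun i => Real.exp (n * weight i) := by
  rw [Matrix.SpecialLinearGroup.coe_pow]
  have : (α : Matrix (Fin 3) (Fin 3) ℝ) = Matrix.diagonal fun i => Real.exp (weight i) := by
    change Matrix.diagonal _ = _
    congr 1
    ext i
    fin_cases i <;> simp [weight]
  rw [this, Matrix.diagonal_pow]
  congr 1
  ext i
  simp [← Real.exp_nat_mul]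

lemma coe_inv_α_pow (n : ℕ) : (((α ^ n)⁻¹ : G) : Matrix (Fin 3) (Fin 3) ℝ) =
    Matrix.diagonal fun i => Real.exp (-(n * weight i)) := by
  have h : ((α ^ n : G) : Matrix (Fin 3) (Fin 3) ℝ) *
      Matrix.diagonal (fun i => Real.exp (-(n * weight i))) = 1 := by
    rw [coe_α_pow, Matrix.diagonal_mul_diagonal]
    simp [← Real.exp_add]
  have h2 : (((α ^ n)⁻¹ : G) : Matrix (Fin 3) (Fin 3) ℝ) * ((α ^ n : G) : Matrix (Fin 3) (Fin 3) ℝ)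
      = 1 := by
    rw [← Matrix.SpecialLinearGroup.coe_mul, inv_mul_cancel, Matrix.SpecialLinearGroup.coe_one]
  exact left_inv_eq_right_inv h2 h

lemma conj_apply (n : ℕ) (g : G) (i j : Fin 3) :
    ((α ^ n)⁻¹ * g * α ^ n) i j = Real.exp (n * (weight j - weight i)) * g i j := by
  rw [Matrix.SpecialLinearGroup.coe_mul, Matrix.SpecialLinearGroup.coe_mul, coe_α_pow,
    coe_inv_α_pow, Matrix.mul_diagonal, Matrix.diagonal_mul, mul_sub, sub_eq_add_neg, Real.exp_add]
  ring

lemma conj_unip (n : ℕ) (v : ℝ × ℝ) :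
    (α ^ n)⁻¹ * unip v * α ^ n = unip (Real.exp (3 * n / 2) • v) := by
  apply Matrix.SpecialLinearGroup.ext
  intro i j
  rw [conj_apply]
  have h : ((n : ℝ) * (1 / 2 + 1)) = 3 * n / 2 := by ring
  fin_cases i <;> fin_cases j <;> simp [coe_unip, weight] <;> left <;> ring_nf

/-- The elements of the parabolic subgroup with vanishing `(2,0)` and `(2,1)` entries whose entries
are within `r` of those of the identity. -/
def parab (r : ℝ) : Set G :=
  {p | p 2 0 = 0 ∧ p 2 1 = 0 ∧ ∀ i j, |p i j - (1 : Matrix (Fin 3) (Fin 3) ℝ) i j| ≤ r}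

lemma parab_mono {r s : ℝ} (h : r ≤ s) : parab r ⊆ parab s :=
  fun _ hp => ⟨hp.1, hp.2.1, fun i j => (hp.2.2 i j).trans h⟩

/-- Conjugation fixes the diagonal blocks, shrinks the (0,2) and (1,2) entries by e^{-3n/2}, and the
entries it would expand vanish. Parabolic errors therefore never need to be coded. -/
lemma conj_mem_parab {r : ℝ} {p : G} (hp : p ∈ parab r) (n : ℕ) :
    (α ^ n)⁻¹ * p * α ^ n ∈ parab r := by
  obtain ⟨h0, h1, h⟩ := hp
  refine ⟨by rw [conj_apply, h0, mul_zero], by rw [conj_apply, h1, mul_zero], fun i j => ?_⟩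
  rw [conj_apply]
  have hr : 0 ≤ r := (abs_nonneg _).trans (h 0 0)
  have key : ∀ x : ℝ, |x| ≤ r → |Real.exp (n * (-1 - 1 / 2)) * x| ≤ r := by
    intro x hx
    rw [abs_mul, abs_of_pos (Real.exp_pos _)]
    have : Real.exp (n * (-1 - 1 / 2)) ≤ 1 := by
      rw [Real.exp_le_one_iff]
      have : (0 : ℝ) ≤ n := n.cast_nonneg
      linarith
    nlinarith [abs_nonneg x]
  have h02 := h 0 2
  have h12 := h 1 2
  have hij := h i j
  fin_cases i <;> fin_cases j <;> simp [weight, h0, h1, hr] at hij h02 h12 ⊢ <;>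
    first
    | exact hij
    | simpa using key _ h02
    | simpa using key _ h12

lemma continuous_entry (i j : Fin 3) : Continuous fun g : G => g i j :=
  (continuous_apply_apply i j).comp
    (continuous_subtype_val : Continuous (Subtype.val : G → Matrix (Fin 3) (Fin 3) ℝ))

lemma exists_entries_subset {N : Set G} (hN : N ∈ 𝓝 (1 : G)) :
    ∃ r > 0, ∀ g : G, (∀ i j, |g i j - (1 : Matrix (Fin 3) (Fin 3) ℝ) i j| ≤ r) → g ∈ N := by
  have hind : Topology.IsInducing (fun (g : G) (i j : Fin 3) => g i j) :=
    (Topology.IsInducing.subtypeVal :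
      Topology.IsInducing (Subtype.val : G → Matrix (Fin 3) (Fin 3) ℝ))
  rw [hind.nhds_eq_comap] at hN
  obtain ⟨V, hV, hVN⟩ := hN
  obtain ⟨r, hr, hr'⟩ := Metric.mem_nhds_iff.1 hV
  refine ⟨r / 2, by positivity, fun g hg => hVN (hr' ?_)⟩
  rw [Metric.mem_ball]
  refine lt_of_le_of_lt ?_ (half_lt_self hr)
  refine (dist_pi_le_iff (by positivity)).2 fun i => (dist_pi_le_iff (by positivity)).2 fun j => ?_
  rw [Real.dist_eq]
  exact hg i j

lemma continuous_unip : Continuous unip := by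
  refine Continuous.subtype_mk ?_ _
  refine continuous_pi fun i => continuous_pi fun j => ?_
  fin_cases i <;> fin_cases j <;> simp <;> fun_prop

/-- By Cramer's rule, `v` is chosen so that multiplying by `unip (-v)` clears the first two entries
of the bottom row. This works where the upper left minor `δ` is nonzero, in particular near the
identity. -/
lemma mul_unip_parab_mem_nhds {r : ℝ} (hr : 0 < r) :
    {h : G | ∃ v : ℝ × ℝ, ‖v‖ ≤ 1 ∧ ∃ p ∈ parab r, unip v * p = h} ∈ 𝓝 (1 : G) := by
  set δ : G → ℝ := fun h => h 0 0 * h 1 1 - h 0 1 * h 1 0 with hδ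
  set v : G → ℝ × ℝ := fun h => ((h 2 0 * h 1 1 - h 2 1 * h 1 0) / δ h,
    (h 2 1 * h 0 0 - h 2 0 * h 0 1) / δ h) with hv
  have hδc : Continuous δ := by
    have := continuous_entry
    fun_prop
  have hδ1 : δ 1 = 1 := by simp [hδ]
  have hv1 : v 1 = 0 := by simp [hv]
  have hvc : ContinuousAt v 1 := by
    have h := continuous_entry
    refine ContinuousAt.prodMk ?_ ?_ <;>
    · refine ContinuousAt.div (Continuous.continuousAt (by fun_prop)) hδc.continuousAt ?_
      rw [hδ1]
      norm_num
  have hpc : ContinuousAt (fun h => unip (-v h) * h) 1 :=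
    (continuous_unip.continuousAt.comp hvc.neg).mul continuousAt_id
  have hev1 : ∀ᶠ h in 𝓝 (1 : G), δ h ≠ 0 :=
    hδc.continuousAt.eventually_ne (by rw [hδ1]; norm_num)
  have hev2 : ∀ᶠ h in 𝓝 (1 : G), ‖v h‖ ≤ 1 := by
    have := hvc.norm
    rw [ContinuousAt, hv1, norm_zero] at this
    exact (this.eventually_lt_const zero_lt_one).mono fun _ => le_of_lt
  have hev3 : ∀ᶠ h in 𝓝 (1 : G), ∀ i j,
      |(unip (-v h) * h) i j - (1 : Matrix (Fin 3) (Fin 3) ℝ) i j| ≤ r := by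
    refine eventually_all.2 fun i => eventually_all.2 fun j => ?_
    have h1 : ContinuousAt (fun h => |(unip (-v h) * h) i j -
        (1 : Matrix (Fin 3) (Fin 3) ℝ) i j|) 1 :=
      (((continuous_entry i j).continuousAt.comp hpc).sub continuousAt_const).abs
    rw [ContinuousAt, hv1, neg_zero, unip_zero, one_mul, Matrix.SpecialLinearGroup.coe_one,
      sub_self, abs_zero] at h1
    exact (h1.eventually_lt_const hr).mono fun _ => le_of_lt
  filter_upwards [hev1, hev2, hev3] with h h1 h2 h3
  refine ⟨v h, h2, unip (-v h) * h, ⟨?_, ?_, h3⟩, ?_⟩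
  · simp only [Matrix.SpecialLinearGroup.coe_mul, coe_unip, Matrix.mul_apply, Fin.sum_univ_three]
    simp [hv]
    field_simp
    simp only [hδ]
    ring
  · simp only [Matrix.SpecialLinearGroup.coe_mul, coe_unip, Matrix.mul_apply, Fin.sum_univ_three]
    simp [hv]
    field_simp
    simp only [hδ]
    ring
  · rw [← mul_assoc, unip_mul, add_neg_cancel, unip_zero, one_mul]

/-- The product `p⁻¹ * unip v * p'` is the displacement between two points of one coding cell. The
bound `r ≤ 1` keeps such cells inside those used to define the compact set `K`. -/
lemma exists_parab_subset {W : Set G} (hW : W ∈ 𝓝 (1 : G)) :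
    ∃ r > 0, r ≤ 1 ∧ ∃ θ > 0, ∀ p ∈ parab r, ∀ p' ∈ parab r, ∀ v : ℝ × ℝ, ‖v‖ ≤ θ →
      p⁻¹ * unip v * p' ∈ W := by
  have hc : Continuous fun q : G × (ℝ × ℝ) × G => q.1⁻¹ * unip q.2.1 * q.2.2 :=
    (continuous_fst.inv.mul (continuous_unip.comp (by fun_prop))).mul (by fun_prop)
  have h2 : (fun q : G × (ℝ × ℝ) × G => q.1⁻¹ * unip q.2.1 * q.2.2) ⁻¹' W ∈
      𝓝 ((1 : G), ((0 : ℝ × ℝ), (1 : G))) := by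
    refine hc.continuousAt.preimage_mem_nhds ?_
    simpa only [inv_one, unip_zero, one_mul] using hW
  obtain ⟨N, hN, M, hM, hNM⟩ := mem_nhds_prod_iff.1 h2
  obtain ⟨V, hV, N', hN', hVN⟩ := mem_nhds_prod_iff.1 hM
  obtain ⟨r, hr, hr'⟩ := exists_entries_subset hN
  obtain ⟨r2, hr2, hr2'⟩ := exists_entries_subset hN'
  obtain ⟨θ, hθ, hθ'⟩ := Metric.mem_nhds_iff.1 hV
  refine ⟨min (min r r2) 1, lt_min (lt_min hr hr2) one_pos, min_le_right _ _, θ / 2, half_pos hθ, ?_⟩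
  intro p hp p' hp' v hv
  have h3 : p ∈ N :=
    hr' p fun i j => (hp.2.2 i j).trans ((min_le_left _ _).trans (min_le_left _ _))
  have h4 : v ∈ V := hθ' (by rw [mem_ball_zero_iff]; linarith)
  have h5 : p' ∈ N' :=
    hr2' p' fun i j => (hp'.2.2 i j).trans ((min_le_left _ _).trans (min_le_right _ _))
  have h6 : (p, v, p') ∈ N ×ˢ M := Set.mk_mem_prod h3 (hVN (Set.mk_mem_prod h4 h5))
  have h7 := hNM h6
  simp only [Set.mem_preimage] at h7
  exact h7

lemma isCompact_entries_le (R : ℝ) : IsCompact {g : G | ∀ i j, |g i j| ≤ R} := by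
  have hcl : IsClosed {M : Matrix (Fin 3) (Fin 3) ℝ | M.det = 1} :=
    isClosed_eq (continuous_id.matrix_det) continuous_const
  have hemb : Topology.IsClosedEmbedding (Subtype.val : G → Matrix (Fin 3) (Fin 3) ℝ) :=
    Topology.IsClosedEmbedding.subtypeVal hcl
  have hK : IsCompact (Set.univ.pi fun _ : Fin 3 => Set.univ.pi fun _ : Fin 3 => Set.Icc (-R) R) :=
    isCompact_univ_pi fun _ => isCompact_univ_pi fun _ => isCompact_Icc
  have hpre := hemb.isCompact_preimage (K := Set.univ.pi fun _ : Fin 3 => Set.univ.pi fun _ : Fin 3 =>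
    Set.Icc (-R) R) hK
  refine hpre.of_isClosed_subset ?_ fun g hg i _ j _ => abs_le.1 (hg i j)
  rw [show {g : G | ∀ i j, |g i j| ≤ R} = ⋂ i, ⋂ j, {g : G | |g i j| ≤ R} by ext; simp]
  exact isClosed_iInter fun i => isClosed_iInter fun j =>
    isClosed_le (continuous_entry i j).abs continuous_const

lemma isCompact_parab (r : ℝ) : IsCompact (parab r) := by
  refine (isCompact_entries_le (1 + r)).of_isClosed_subset ?_ ?_
  · have h := continuous_entry
    rw [show parab r = {p : G | p 2 0 = 0} ∩ ({p : G | p 2 1 = 0} ∩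
      ⋂ i, ⋂ j, {p : G | |p i j - (1 : Matrix (Fin 3) (Fin 3) ℝ) i j| ≤ r}) by ext; simp [parab]]
    refine (isClosed_eq (h 2 0) continuous_const).inter
      ((isClosed_eq (h 2 1) continuous_const).inter ?_)
    exact isClosed_iInter fun i => isClosed_iInter fun j =>
      isClosed_le ((h i j).sub continuous_const).abs continuous_const
  · intro p hp i j
    have h1 := abs_sub_abs_le_abs_sub (p i j) ((1 : Matrix (Fin 3) (Fin 3) ℝ) i j)
    have h2 : |(1 : Matrix (Fin 3) (Fin 3) ℝ) i j| ≤ 1 := by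
      rw [Matrix.one_apply]
      split_ifs <;> simp
    linarith [hp.2.2 i j]

/-- The set of `x u p` for `x` in a compact set, `‖v‖ ≤ 1`, `p` in a fixed parabolic ball is compact. -/
lemma isCompact_mul_unip_parab {C : Set G} (hC : IsCompact C) :
    IsCompact {h : G | ∃ x ∈ C, ∃ v : ℝ × ℝ, ‖v‖ ≤ 1 ∧ ∃ p ∈ parab 1, x * unip v * p = h} := by
  have hc : Continuous fun q : G × (ℝ × ℝ) × G => q.1 * unip q.2.1 * q.2.2 :=
    (continuous_fst.mul (continuous_unip.comp (by fun_prop))).mul (by fun_prop)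
  have h := (hC.prod ((isCompact_closedBall (0 : ℝ × ℝ) 1).prod (isCompact_parab 1))).image hc
  refine Eq.mp (congrArg IsCompact (Set.ext fun y => ⟨?_, ?_⟩)) h
  · rintro ⟨⟨x, v, p⟩, ⟨hx, hv, hp⟩, rfl⟩
    exact ⟨x, hx, v, mem_closedBall_zero_iff.1 hv, p, hp, rfl⟩
  · rintro ⟨x, hx, v, hv, p, hp, rfl⟩
    exact ⟨(x, v, p), ⟨hx, mem_closedBall_zero_iff.2 hv, hp⟩, rfl⟩

end Group

/-! ### Digit expansions on the horosphere and the weighted walk. -/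

section Walk

/-- Pairs of integers of absolute value at most `L`, standing for the points of the grid of mesh
`1 / L` in the square `[-1, 1]²`. -/
abbrev Digit (L : ℕ) : Type :=
  ↥(Finset.Icc (-(L : ℤ)) L) × ↥(Finset.Icc (-(L : ℤ)) L)

/-- The grid point of a digit. -/
noncomputable def gridPt {L : ℕ} (d : Digit L) : ℝ × ℝ := (((d.1 : ℤ) : ℝ) / L, ((d.2 : ℤ) : ℝ) / L)

lemma exists_int_near {L : ℕ} (hL : 0 < L) {x : ℝ} (hx : |x| ≤ 1) :
    ∃ k : ↥(Finset.Icc (-(L : ℤ)) L), |x - ((k : ℤ) : ℝ) / L| ≤ 1 / L := by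
  have hL' : (0 : ℝ) < L := by exact_mod_cast hL
  rw [abs_le] at hx
  refine ⟨⟨⌊x * L⌋, Finset.mem_Icc.2 ⟨?_, ?_⟩⟩, ?_⟩
  · rw [Int.le_floor]
    push_cast
    nlinarith
  · have : (⌊x * L⌋ : ℝ) ≤ L := (Int.floor_le _).trans (by nlinarith)
    exact_mod_cast this
  · have h1 := Int.floor_le (x * L)
    have h2 := Int.lt_floor_add_one (x * L)
    rw [show x - (⌊x * L⌋ : ℝ) / L = (x * L - ⌊x * L⌋) / L by field_simp, abs_div,
      abs_of_pos hL', abs_of_nonneg (by linarith)]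
    gcongr
    linarith

lemma exists_gridPt_near {L : ℕ} (hL : 0 < L) {v : ℝ × ℝ} (hv : ‖v‖ ≤ 1) :
    ∃ d : Digit L, ‖v - gridPt d‖ ≤ 1 / L := by
  rw [Prod.norm_def, max_le_iff] at hv
  obtain ⟨k, hk⟩ := exists_int_near hL hv.1
  obtain ⟨l, hl⟩ := exists_int_near hL hv.2
  exact ⟨(k, l), by rw [Prod.norm_def]; exact max_le hk hl⟩

lemma norm_gridPt_le {L : ℕ} (d : Digit L) : ‖gridPt d‖ ≤ 1 := by
  have key : ∀ k : ↥(Finset.Icc (-(L : ℤ)) L), |((k : ℤ) : ℝ) / L| ≤ 1 := by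
    rintro ⟨k, hk⟩
    rw [Finset.mem_Icc] at hk
    rw [abs_div, Nat.abs_cast]
    refine div_le_one_of_le₀ ?_ (Nat.cast_nonneg _)
    rw [abs_le]
    exact ⟨by exact_mod_cast hk.1, by exact_mod_cast hk.2⟩
  rw [Prod.norm_def]
  exact max_le (key _) (key _)

lemma card_digit (L : ℕ) : Fintype.card (Digit L) = (2 * L + 1) ^ 2 := by
  rw [Fintype.card_prod, Fintype.card_coe, Int.card_Icc, sq]
  congr 1 <;> omega

variable (t : ℕ) {L : ℕ}

/-- One step of the walk: move by a grid point of the expanded horosphere, then flow for time `t`. -/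
noncomputable def step (x : G) (d : Digit L) : G := x * unip (gridPt d) * α ^ t

/-- `v` is coded by the word `w`: the successive remainders, rescaled, stay in `[-1, 1]²`. -/
def Codes : ∀ N : ℕ, ℝ × ℝ → (Fin N → Digit L) → Prop
  | 0, v, _ => ‖v‖ ≤ 1
  | N + 1, v, w => ‖v‖ ≤ 1 ∧ Codes N (Real.exp (3 * t / 2) • (v - gridPt (w 0))) (Fin.tail w)

variable {t}

lemma Codes.norm_le {N : ℕ} {v : ℝ × ℝ} {w : Fin N → Digit L} (h : Codes t N v w) : ‖v‖ ≤ 1 := by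
  cases N with
  | zero => exact h
  | succ N => exact h.1

/-- Greedy expansion: some grid point leaves a remainder of size at most 1/L ≤ e^{-3t/2}, which
rescales back into the square. -/
lemma exists_codes (hL : Real.exp (3 * t / 2) ≤ L) (N : ℕ) {v : ℝ × ℝ} (hv : ‖v‖ ≤ 1) :
    ∃ w : Fin N → Digit L, Codes t N v w := by
  have hL' : (0 : ℝ) < L := (Real.exp_pos _).trans_le hL
  induction N generalizing v with
  | zero => exact ⟨Fin.elim0, hv⟩
  | succ N ih =>
    obtain ⟨d, hd⟩ := exists_gridPt_near (by exact_mod_cast hL') hv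
    obtain ⟨w, hw⟩ := ih (v := Real.exp (3 * t / 2) • (v - gridPt d)) (by
      rw [norm_smul, Real.norm_of_nonneg (Real.exp_pos _).le]
      calc Real.exp (3 * t / 2) * ‖v - gridPt d‖ ≤ L * (1 / L) := by gcongr
        _ = 1 := by field_simp)
    exact ⟨Fin.cons d w, hv, by simpa using hw⟩

/-- Equal digits subtract equal grid points, so each step multiplies the difference by e^{3t/2}, and
it is still at most 2 at the end. -/
lemma Codes.norm_sub_le {N : ℕ} {v v' : ℝ × ℝ} {w : Fin N → Digit L} (h : Codes t N v w)
    (h' : Codes t N v' w) : Real.exp (3 * t / 2) ^ N * ‖v - v'‖ ≤ 2 := by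
  induction N generalizing v v' with
  | zero =>
    have h1 : ‖v‖ ≤ 1 := h
    have h2 : ‖v'‖ ≤ 1 := h'
    rw [pow_zero, one_mul]
    linarith [_root_.norm_sub_le v v']
  | succ N ih =>
    have := ih h.2 h'.2
    rw [← smul_sub, sub_sub_sub_cancel_right, norm_smul,
      Real.norm_of_nonneg (Real.exp_pos _).le] at this
    rw [pow_succ]
    linarith

/-- The walk shadows the orbit: after time `t` the point again has the form position, coded
remainder, parabolic error. -/
lemma step_mul (x : G) (d : Digit L) (v : ℝ × ℝ) (p : G) :
    x * unip v * p * α ^ t = step t x d * unip (Real.exp (3 * t / 2) • (v - gridPt d)) *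
      ((α ^ t)⁻¹ * p * α ^ t) := by
  rw [← conj_unip, step, sub_eq_neg_add, ← unip_mul, ← inv_unip]
  group

variable (t) in
/-- The weight of a word in the walk with transition weights proportional to
`φ (step x d) / φ x`, normalised by `ω x`. -/
noncomputable def walkWeight (φ ω : G → ℝ) : ∀ N : ℕ, G → (Fin N → Digit L) → ℝ
  | 0, _, _ => 1
  | N + 1, x, w => (Fintype.card (Digit L) : ℝ)⁻¹ * (ω x)⁻¹ * (φ (step t x (w 0)) / φ x) *
      walkWeight φ ω N (step t x (w 0)) (Fin.tail w)

variable {φ ω : G → ℝ}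

lemma card_digit_pos : (0 : ℝ) < Fintype.card (Digit L) := by
  rw [card_digit]
  positivity

lemma walkWeight_pos (hφ : ∀ x, 1 ≤ φ x) (hω : ∀ x, 0 < ω x) (N : ℕ) (x : G)
    (w : Fin N → Digit L) : 0 < walkWeight t φ ω N x w := by
  induction N generalizing x with
  | zero => exact one_pos
  | succ N ih =>
    have h1 := zero_lt_one.trans_le (hφ x)
    have h2 := zero_lt_one.trans_le (hφ (step t x (w 0)))
    have h3 := hω x
    have h4 := ih (step t x (w 0)) (Fin.tail w)
    have h5 := card_digit_pos (L := L)
    rw [walkWeight]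
    positivity

/-- Sum over the tail of the word first, by induction; `havg` then says that the weights of the
first digit sum to at most 1. -/
lemma sum_walkWeight_le (hφ : ∀ x, 1 ≤ φ x) (hω : ∀ x, 0 < ω x)
    (havg : ∀ x, ∑ d : Digit L, φ (step t x d) ≤ Fintype.card (Digit L) * (ω x * φ x)) (N : ℕ)
    (x : G) : ∑ w : Fin N → Digit L, walkWeight t φ ω N x w ≤ 1 := by
  induction N generalizing x with
  | zero => simp [walkWeight]
  | succ N ih =>
    have h1 := zero_lt_one.trans_le (hφ x)
    have h3 := hω x
    have h5 := card_digit_pos (L := L)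
    rw [← (Fin.consEquiv fun _ => Digit L).sum_comp, Fintype.sum_prod_type]
    simp only [Fin.consEquiv_apply, walkWeight, Fin.cons_zero]
    calc ∑ d, ∑ w, (Fintype.card (Digit L) : ℝ)⁻¹ * (ω x)⁻¹ * (φ (step t x d) / φ x) *
          walkWeight t φ ω N (step t x d) w
        ≤ ∑ d, (Fintype.card (Digit L) : ℝ)⁻¹ * (ω x)⁻¹ * (φ (step t x d) / φ x) := by
          refine Finset.sum_le_sum fun d _ => ?_
          rw [← Finset.mul_sum]
          have h2 := zero_lt_one.trans_le (hφ (step t x d))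
          exact mul_le_of_le_one_right (by positivity) (ih _)
      _ = (∑ d : Digit L, φ (step t x d)) / (Fintype.card (Digit L) * (ω x * φ x)) := by
          rw [Finset.sum_div]
          refine Finset.sum_congr rfl fun d _ => ?_
          field_simp
      _ ≤ 1 := div_le_one_of_le₀ (havg x) (by positivity)

-- The ratios of `φ` telescope to `log (φ x)` minus a final logarithm, which is nonnegative and can
-- be dropped. If the orbit is outside `K` at the start of a block, then the walk is outside `S` by
-- `hSK`, so the normalisation `ω` is smaller by the factor `exp (-β)` there.
open Classical in
lemma neg_log_walkWeight_le {S : Set G} {β : ℝ} {K : Set X}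
    (hφ : ∀ x, 1 ≤ φ x) (hβ : 0 ≤ β)
    (hω : ω = fun x => if x ∈ S then 2 else 2 * Real.exp (-β))
    (hSK : ∀ x ∈ S, ∀ v : ℝ × ℝ, ‖v‖ ≤ 1 → ∀ p ∈ parab 1, proj (x * unip v * p) ∈ K)
    {N : ℕ} {x : G} {v : ℝ × ℝ} {w : Fin N → Digit L} (h : Codes t N v w) {p : G}
    (hp : p ∈ parab 1) :
    -Real.log (walkWeight t φ ω N x w) ≤ N * (Real.log (Fintype.card (Digit L)) + Real.log 2) +
      Real.log (φ x) -
      β * ∑ j ∈ Finset.range N, Kᶜ.indicator 1 (T^[t * j] (proj (x * unip v * p))) := by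
  have hωpos : ∀ x, 0 < ω x := by
    intro x
    rw [hω]
    dsimp only
    split_ifs <;> positivity
  induction N generalizing x v p with
  | zero => simpa [walkWeight] using Real.log_nonneg (hφ x)
  | succ N ih =>
    have h1 := zero_lt_one.trans_le (hφ x)
    have h2 := zero_lt_one.trans_le (hφ (step t x (w 0)))
    have h3 := hωpos x
    have h4 := walkWeight_pos (t := t) hφ hωpos N (step t x (w 0)) (Fin.tail w)
    have h5 := card_digit_pos (L := L)
    have h6 := ih (x := step t x (w 0)) h.2 (conj_mem_parab hp t)
    have h7 : ∀ j, T^[t * (j + 1)] (proj (x * unip v * p)) = T^[t * j] (proj (step t x (w 0) *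
        unip (Real.exp (3 * t / 2) • (v - gridPt (w 0))) * ((α ^ t)⁻¹ * p * α ^ t))) := by
      intro j
      rw [← step_mul, mul_add, mul_one, Function.iterate_add_apply, iterate_T_proj t]
    have h8 : Real.log (ω x) ≤
        Real.log 2 - β * Kᶜ.indicator (1 : X → ℝ) (proj (x * unip v * p)) := by
      rw [hω]
      dsimp only
      by_cases hx : x ∈ S
      · have : proj (x * unip v * p) ∉ Kᶜ := fun hc => hc (hSK x hx v h.norm_le p hp)
        rw [if_pos hx, Set.indicator_of_notMem this]
        simp
      · rw [if_neg hx, Real.log_mul (by norm_num) (Real.exp_ne_zero _), Real.log_exp]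
        by_cases hc : proj (x * unip v * p) ∈ Kᶜ
        · rw [Set.indicator_of_mem hc]
          simp [sub_eq_add_neg]
        · rw [Set.indicator_of_notMem hc]
          simpa using hβ
    rw [walkWeight, Real.log_mul (by positivity) h4.ne', Real.log_mul (by positivity) (by positivity),
      Real.log_mul (by positivity) (by positivity), Real.log_inv, Real.log_inv,
      Real.log_div h2.ne' h1.ne', Finset.sum_range_succ']
    simp only [h7]
    push_cast
    simp only [mul_zero, Function.iterate_zero, id]
    linarith

end Walk

/-! ### From a contracted height to an entropy bound. -/

section EntropyBound

variable {μ : Measure X}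

lemma integrable_indicator_iterate [IsProbabilityMeasure μ] {A : Set X} (hA : MeasurableSet A) (j : ℕ) :
    Integrable (fun y => A.indicator (1 : X → ℝ) (T^[j] y)) μ :=
  (((integrable_const (1 : ℝ)).indicator (hA.preimage (continuous_T.measurable.iterate j))).congr
    (ae_of_all _ fun _ => rfl))

lemma integral_indicator_iterate (hT : MeasurePreserving T μ μ) {A : Set X} (hA : MeasurableSet A)
    (j : ℕ) : ∫ y, A.indicator (1 : X → ℝ) (T^[j] y) ∂μ = μ.real A := by
  have h1 : (fun y => A.indicator (1 : X → ℝ) (T^[j] y)) = (T^[j] ⁻¹' A).indicator 1 := rfl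
  rw [h1, integral_indicator_one (hA.preimage (continuous_T.measurable.iterate j)), measureReal_def,
    (hT.iterate j).measure_preimage hA.nullMeasurableSet, measureReal_def]

/-- Finitely many starting points for the walk suffice, so naming the start and its initial height
adds a cost independent of `n`. -/
lemma exists_finset_cover {K : Set X} (hK : IsCompact K) {r : ℝ} (hr : 0 < r) :
    ∃ I : Finset G, ∀ y ∈ K, ∃ g ∈ I, ∃ v : ℝ × ℝ, ‖v‖ ≤ 1 ∧ ∃ p ∈ parab r,
      y = proj (g * unip v * p) := by
  classical
  have hnhds := mul_unip_parab_mem_nhds hr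
  set B := {h : G | ∃ v : ℝ × ℝ, ‖v‖ ≤ 1 ∧ ∃ p ∈ parab r, unip v * p = h} with hB
  let rep := Function.surjInv isOpenQuotientMap_proj.surjective
  have hrep : ∀ x, proj (rep x) = x := Function.surjInv_eq isOpenQuotientMap_proj.surjective
  obtain ⟨J, -, hJ⟩ := hK.elim_nhds_subcover (fun x => proj '' ((fun h => rep x * h) '' B)) (by
    intro x _
    have h1 : (fun h => rep x * h) '' B ∈ 𝓝 (rep x) := by
      have := (isOpenMap_mul_left (rep x)).image_mem_nhds hnhds
      rwa [mul_one] at this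
    have := isOpenQuotientMap_proj.isOpenMap.image_mem_nhds h1
    rwa [hrep] at this)
  refine ⟨J.image rep, fun y hy => ?_⟩
  obtain ⟨x, hx, hyx⟩ := Set.mem_iUnion₂.1 (hJ hy)
  obtain ⟨-, ⟨-, ⟨v, hv, p, hp, rfl⟩, rfl⟩, rfl⟩ := hyx
  exact ⟨rep x, Finset.mem_image_of_mem _ hx, v, hv, p, hp, by rw [mul_assoc]⟩

/-- Two points with the same long code have nearby orbits. -/
lemma exists_translate_eq {t L : ℕ} {N n s : ℕ} (hN : n + s ≤ t * N) {W : Set G} {r θ : ℝ}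
    (hW : ∀ p ∈ parab r, ∀ p' ∈ parab r, ∀ v : ℝ × ℝ, ‖v‖ ≤ θ → p⁻¹ * unip v * p' ∈ W)
    (hs : 2 * Real.exp (-(3 * s / 2)) ≤ θ) {w : Fin N → Digit L} {g p p' : G} {v v' : ℝ × ℝ}
    (hp : p ∈ parab r) (hp' : p' ∈ parab r) (hv : Codes t N v w) (hv' : Codes t N v' w)
    {j : ℕ} (hj : j ≤ n) :
    ∃ h ∈ W, T^[j] (proj (g * unip v' * p')) = translate (T^[j] (proj (g * unip v * p))) h := by
  refine ⟨_, hW _ (conj_mem_parab hp j) _ (conj_mem_parab hp' j)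
    (Real.exp (3 * j / 2) • (v' - v)) ?_, ?_⟩
  · have h1 := hv'.norm_sub_le hv
    rw [norm_smul, Real.norm_of_nonneg (Real.exp_pos _).le]
    rw [← Real.exp_nat_mul] at h1
    have hN' : ((n : ℝ) + s) ≤ t * N := by exact_mod_cast hN
    have hj' : (j : ℝ) ≤ n := by exact_mod_cast hj
    -- The margin `s`: the code reaches beyond time `n + s`, so up to time `n` the separation is
    -- still at most 2 e^{-3s/2}.
    calc Real.exp (3 * j / 2) * ‖v' - v‖
        = Real.exp (3 * j / 2 - N * (3 * t / 2)) * (Real.exp (N * (3 * t / 2)) * ‖v' - v‖) := by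
          rw [← mul_assoc, ← Real.exp_add, sub_add_cancel]
      _ ≤ Real.exp (-(3 * s / 2)) * 2 := by
          gcongr
          nlinarith
      _ ≤ θ := by linarith
  · rw [iterate_T_proj, iterate_T_proj, translate_proj, ← conj_unip, sub_eq_neg_add, ← unip_mul,
      ← inv_unip]
    congr 1
    group

lemma neg_log_one_sub_le {e : ℝ} (he : 0 < e) (he2 : e ≤ 1 / 2) : -Real.log (1 - e) ≤ 2 * e := by
  have h := Real.one_sub_inv_le_log_of_pos (show 0 < 1 - e by linarith)
  have h2 : (1 - e)⁻¹ ≤ 1 + 2 * e := by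
    rw [inv_le_iff_one_le_mul₀ (by linarith)]
    nlinarith
  linarith

variable [IsProbabilityMeasure μ]

/-- Inner regularity. On disjoint compact pieces, sufficiently close points carry the same label;
visits to the small remaining set are treated as coding errors. -/
lemma exists_disjoint_compacts {k : ℕ} {ξ : X → Fin k} (hξ : Measurable ξ) {δ : ℝ} (hδ : 0 < δ) :
    ∃ K : Fin k → Set X, (∀ a, IsCompact (K a)) ∧ (∀ a, ∀ x ∈ K a, ξ x = a) ∧
      μ.real (⋃ a, K a)ᶜ ≤ δ := by
  have h : ∀ a : Fin k, ∃ K ⊆ ξ ⁻¹' {a}, IsCompact K ∧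
      μ (ξ ⁻¹' {a} \ K) < ENNReal.ofReal (δ / k) := fun a => by
    have hk : (0 : ℝ) < k := by exact_mod_cast a.pos
    exact (hξ (measurableSet_singleton a)).exists_isCompact_sdiff_lt (measure_ne_top _ _)
      (ENNReal.ofReal_pos.2 (by positivity)).ne'
  choose K hKsub hK hμ using h
  refine ⟨K, hK, fun a x hx => hKsub a hx, ?_⟩
  have hsub : (⋃ a, K a)ᶜ ⊆ ⋃ a, (ξ ⁻¹' {a} \ K a) := by
    intro x hx
    simp only [Set.mem_compl_iff, Set.mem_iUnion, not_exists] at hx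
    exact Set.mem_iUnion.2 ⟨ξ x, rfl, hx _⟩
  calc μ.real (⋃ a, K a)ᶜ ≤ μ.real (⋃ a, (ξ ⁻¹' {a} \ K a)) := measureReal_mono hsub
    _ ≤ ∑ a : Fin k, μ.real (ξ ⁻¹' {a} \ K a) := measureReal_iUnion_fintype_le _
    _ ≤ ∑ _a : Fin k, δ / k := by
        refine Finset.sum_le_sum fun a _ => ?_
        exact ENNReal.toReal_le_of_le_ofReal (by positivity) (hμ a).le
    _ ≤ δ := by
        rw [Finset.sum_const, Finset.card_univ, Fintype.card_fin, nsmul_eq_mul]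
        rcases Nat.eq_zero_or_pos k with rfl | hk
        · simpa using hδ.le
        · have : (0 : ℝ) < k := by exact_mod_cast hk
          rw [mul_div_cancel₀ _ this.ne']

/-- Final bookkeeping: `N * R` is about 3n and the saving about n(1 - m). The excess of `t * N` over
`n` is at most `s + t` and enters only the constant term. -/
lemma mean_code_length_le {A₀ N n s t R β m m' b l ε δ : ℝ} (hN : 0 ≤ N) (hn : 0 ≤ n)
    (ht : 0 ≤ t) (hNt : t * N ≤ n + s + t) (hm0 : 0 ≤ m) (hm1 : m ≤ 1) (hm' : 0 ≤ m')
    (hm'δ : m' ≤ δ) (hb : 0 ≤ b) (hl : 0 ≤ l) (hβt : β ≤ t) (hR : R ≤ (3 + ε) * t)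
    (hβ : (1 - ε) * t ≤ β) (hε : 0 ≤ ε) (hδ : δ * (1 + b + l) = ε / 2) :
    A₀ + N * R - β * (N * (1 - m)) + n * (ε / 2) + b * (n * m') + (n * l + β * N) * m' ≤
      A₀ + (s + t) * (2 + 2 * ε + m + δ) + n * (2 + 3 * ε + m) := by
  have hδ0 : 0 ≤ δ := hm'.trans hm'δ
  have e1 : N * R ≤ N * ((3 + ε) * t) := mul_le_mul_of_nonneg_left hR hN
  have e2 : N * (((1 - ε) * t) * (1 - m)) ≤ N * (β * (1 - m)) :=
    mul_le_mul_of_nonneg_left (mul_le_mul_of_nonneg_right hβ (by linarith)) hN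
  have e3 : (n * l + β * N) * m' ≤ (n * l + t * N) * δ :=
    mul_le_mul (by gcongr) hm'δ hm' (by positivity)
  have e4 : b * (n * m') ≤ b * (n * δ) := by gcongr
  have e5 : (t * N) * (2 + 2 * ε + m + δ) ≤ (n + s + t) * (2 + 2 * ε + m + δ) := by gcongr
  have e6 : 0 ≤ t * N * (ε * m) := by positivity
  have e7 : n * (δ * (1 + b + l)) = n * (ε / 2) := by rw [hδ]
  linarith

set_option maxHeartbeats 1000000 in
open Classical in
/-- If `φ` is contracted by `2 e ^ (-β)`, with `β` close to `t`, under the walk off a set lying over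
the compact set `K`, and at most doubled elsewhere, then the entropy is at most `2 + μ(K)` up to a
small error. -/
theorem entropy_le_of_walk {t L : ℕ} (hL : Real.exp (3 * t / 2) ≤ L)
    {φ : G → ℝ} (hφ : ∀ x, 1 ≤ φ x) {S : Set G} {β ε : ℝ} (hβ : 0 ≤ β) (hε : 0 < ε)
    (hε1 : ε ≤ 1)
    (havg : ∀ x, ∑ d : Digit L, φ (step t x d) ≤
      Fintype.card (Digit L) * ((if x ∈ S then 2 else 2 * Real.exp (-β)) * φ x))
    {K : Set X} (hKc : IsCompact K)
    (hSK : ∀ x ∈ S, ∀ v : ℝ × ℝ, ‖v‖ ≤ 1 → ∀ p ∈ parab 1, proj (x * unip v * p) ∈ K)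
    (ht : 0 < t) (hR : Real.log (Fintype.card (Digit L)) + Real.log 2 ≤ (3 + ε) * t)
    (hβ1 : (1 - ε) * t ≤ β) (hβ2 : β ≤ t) (hT : MeasurePreserving T μ μ) :
    entropy T μ ≤ ((2 + 3 * ε + μ.real K : ℝ) : EReal) := by
  refine iSup_le fun k => iSup_le fun ξ => iSup_le fun hξ => ?_
  have hk : 0 < k := (ξ (proj 1)).pos
  have hk1 : (1 : ℝ) ≤ k := by exact_mod_cast hk
  have hlogk : 0 ≤ Real.log k := Real.log_nonneg hk1
  set ω : G → ℝ := fun x => if x ∈ S then 2 else 2 * Real.exp (-β) with hω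
  have hωpos : ∀ x, 0 < ω x := by
    intro x
    simp only [hω]
    split_ifs <;> positivity
  -- The noise level is chosen so that the cost `-log (1 - e) ≤ 2 * e` per letter is at most ε/2.
  set e : ℝ := ε / 4 with he
  have he0 : 0 < e := by positivity
  have he1 : e ≤ 1 / 4 := by linarith
  have hloge : Real.log e ≤ 0 := Real.log_nonpos he0.le (by linarith)
  set b : ℝ := Real.log k - Real.log e with hb
  have hb0 : 0 ≤ b := by linarith
  -- `δ` bounds the measure outside `B`. Per unit time that set costs at most `b` for wrong guesses,
  -- `log k` for the uniform code, and about 1 for savings not realised.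
  set δ : ℝ := ε / (2 * (1 + b + Real.log k)) with hδ
  have hδ0 : 0 < δ := by positivity
  have hδ1 : δ * (1 + b + Real.log k) = ε / 2 := by
    rw [hδ]
    field_simp
  obtain ⟨C, hCc, hCξ, hCμ⟩ := exists_disjoint_compacts (μ := μ) hξ hδ0
  obtain ⟨W, hW, hWsep⟩ := exists_nhds_one_separating hCc (by
    intro a a' haa
    refine Set.disjoint_left.2 fun x hx hx' => haa ?_
    rw [← hCξ a x hx, ← hCξ a' x hx'])
  obtain ⟨r, hr, hr1, θ, hθ, hWr⟩ := exists_parab_subset hW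
  obtain ⟨s, hs⟩ : ∃ s : ℕ, 2 * Real.exp (-(3 * s / 2)) ≤ θ := by
    have hlim : Tendsto (fun s : ℕ => 2 * Real.exp (-(3 * s / 2))) atTop (𝓝 (2 * 0)) := by
      refine Tendsto.const_mul _ (Real.tendsto_exp_neg_atTop_nhds_zero.comp ?_)
      exact (tendsto_natCast_atTop_atTop.const_mul_atTop (by norm_num)).atTop_div_const
        (by norm_num)
    rw [mul_zero] at hlim
    exact ((hlim.eventually_lt_const hθ).exists).imp fun _ h => h.le
  set B : Set X := ⋃ a, C a with hB
  have hBc : IsCompact B := isCompact_iUnion hCc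
  have hBm : MeasurableSet Bᶜ := hBc.isClosed.measurableSet.compl
  have hKm : MeasurableSet Kᶜ := hKc.isClosed.measurableSet.compl
  obtain ⟨I, hI⟩ := exists_finset_cover hBc hr
  have hlogI : 0 ≤ Real.log I.card := Real.log_natCast_nonneg _
  have hlogφ : ∀ g ∈ I, Real.log (φ g) ≤ ∑ g ∈ I, Real.log (φ g) := fun g hg =>
    Finset.single_le_sum (f := fun g => Real.log (φ g)) (fun g _ => Real.log_nonneg (hφ g)) hg
  have hlogφ0 : 0 ≤ ∑ g ∈ I, Real.log (φ g) := Finset.sum_nonneg fun g _ => Real.log_nonneg (hφ g)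
  have hm0 : 0 ≤ μ.real K := measureReal_nonneg
  have hm1 : μ.real K ≤ 1 := measureReal_le_one
  have hcompl : μ.real Kᶜ = 1 - μ.real K := probReal_compl_eq_one_sub hKc.isClosed.measurableSet
  set A₀ : ℝ := Real.log 2 + Real.log I.card + ∑ g ∈ I, Real.log (φ g) with hA₀
  have hlog2 : 0 ≤ Real.log 2 := Real.log_nonneg (by norm_num)
  set R : ℝ := Real.log (Fintype.card (Digit L)) + Real.log 2 with hRdef
  have hR0 : 0 ≤ R := add_nonneg (Real.log_natCast_nonneg _) hlog2
  have ht' : (0 : ℝ) < t := by exact_mod_cast ht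
  refine entropyOfPartition_le (A := A₀ + (s + t) * (2 + 2 * ε + μ.real K + δ)) fun n => ?_
  set N : ℕ := (n + s) / t + 1 with hN
  have hN1 : n + s ≤ t * N := (Nat.lt_mul_div_succ _ ht).le
  have hN2 : t * N ≤ n + s + t := by
    rw [hN, mul_add, mul_one]
    exact Nat.add_le_add_right (Nat.mul_div_le _ _) _
  let Code := ↥I × (Fin N → Digit L)
  let Q : Code → ℝ := fun c => (I.card : ℝ)⁻¹ * walkWeight t φ ω N c.1 c.2
  let InCell : Code → X → Prop := fun c y =>
    ∃ v, ∃ p ∈ parab r, Codes t N v c.2 ∧ y = proj (c.1 * unip v * p)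
  have hQpos : ∀ c, 0 < Q c := fun c => by
    have h1 : (0 : ℝ) < I.card := by exact_mod_cast (Finset.card_pos (s := I)).2 ⟨c.1, c.1.2⟩
    exact mul_pos (inv_pos.2 h1) (walkWeight_pos hφ hωpos _ _ _)
  have hQsum : ∑ c, Q c ≤ 1 := by
    rw [Fintype.sum_prod_type]
    calc ∑ g : ↥I, ∑ w, (I.card : ℝ)⁻¹ * walkWeight t φ ω N g w ≤ ∑ _g : ↥I, (I.card : ℝ)⁻¹ := by
          refine Finset.sum_le_sum fun g _ => ?_
          rw [← Finset.mul_sum]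
          exact mul_le_of_le_one_right (by positivity) (sum_walkWeight_le hφ hωpos havg N g)
      _ ≤ 1 := by
          rw [Finset.sum_const, Finset.card_univ, Fintype.card_coe, nsmul_eq_mul]
          exact mul_inv_le_one
  -- At time `j` a cell meets at most one of the sets `C a`, by the separation above, so the choice
  -- is immaterial. The default letter serves the cells that meet none.
  let guess : Code → Fin n → Fin k := fun c j =>
    if h : ∃ a, ∃ y, InCell c y ∧ T^[j] y ∈ C a then h.choose else ⟨0, hk⟩
  have hguess : ∀ c y, InCell c y → ∀ j : Fin n, T^[j] y ∈ B → ξ (T^[j] y) = guess c j := by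
    rintro c y hy j hj
    obtain ⟨a, ha⟩ := Set.mem_iUnion.1 hj
    have hex : ∃ a, ∃ y, InCell c y ∧ T^[j] y ∈ C a := ⟨a, y, hy, ha⟩
    have hg : guess c j = hex.choose := dif_pos hex
    obtain ⟨y', hy', hay'⟩ := hex.choose_spec
    rw [hg, hCξ a _ ha]
    obtain ⟨v, p, hp, hv, rfl⟩ := hy
    obtain ⟨v', p', hp', hv', rfl⟩ := hy'
    obtain ⟨h, hhW, hh⟩ := exists_translate_eq hN1 hWr hs (g := c.1) hp hp' hv hv' j.2.le
    rw [hh] at hay'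
    exact hWsep _ _ _ h hhW ha hay'
  have hbound : ∀ y, -Real.log (mixture e Q guess (itinerary T ξ n y)) ≤
      A₀ + N * R - β * (∑ j ∈ Finset.range N, Kᶜ.indicator (1 : X → ℝ) (T^[t * j] y)) +
        n * (ε / 2) + b * (∑ j ∈ Finset.range n, Bᶜ.indicator (1 : X → ℝ) (T^[j] y)) +
        (n * Real.log k + β * N) * Bᶜ.indicator (1 : X → ℝ) (T^[0] y) := by
    intro y
    have hind : ∀ (D : Set X) (z : X), 0 ≤ D.indicator (1 : X → ℝ) z := fun D z =>
      Set.indicator_nonneg (fun _ _ => zero_le_one) z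
    have hb1 : 0 ≤ b * (∑ j ∈ Finset.range n, Bᶜ.indicator (1 : X → ℝ) (T^[j] y)) :=
      mul_nonneg hb0 (Finset.sum_nonneg fun j _ => hind _ _)
    by_cases hy : y ∈ B
    · obtain ⟨g, hg, v, hv, p, hp, rfl⟩ := hI y hy
      obtain ⟨w, hw⟩ := exists_codes hL N hv
      let c : Code := (⟨g, hg⟩, w)
      have hc : InCell c (proj (g * unip v * p)) := ⟨v, p, hp, hw, rfl⟩
      have h1 := neg_log_mixture_le guess hk he0 (by linarith) (fun c => (hQpos c).le)
        (itinerary T ξ n (proj (g * unip v * p))) (hQpos c)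
      have h2 := neg_log_walkWeight_le hφ hβ hω hSK (x := g) hw (parab_mono hr1 hp)
      have h3 : ∑ j : Fin n, (if itinerary T ξ n (proj (g * unip v * p)) j = guess c j then (0 : ℝ)
          else 1) ≤ ∑ j ∈ Finset.range n, Bᶜ.indicator (1 : X → ℝ)
            (T^[j] (proj (g * unip v * p))) := by
        rw [Finset.sum_range fun j => Bᶜ.indicator (1 : X → ℝ) (T^[j] (proj (g * unip v * p)))]
        refine Finset.sum_le_sum fun j _ => ?_
        split_ifs with hj
        · exact hind _ _
        · rw [Set.indicator_of_mem (s := Bᶜ) fun hjB => hj (hguess c _ hc j hjB)]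
          rfl
      have h4 := mul_le_mul_of_nonneg_left h3 hb0
      have h5 := neg_log_one_sub_le he0 (by linarith)
      have h6 := mul_le_mul_of_nonneg_left h5 (Nat.cast_nonneg (α := ℝ) n)
      have h7 : Real.log (Q c) = -Real.log I.card + Real.log (walkWeight t φ ω N g w) := by
        have h1 : (0 : ℝ) < I.card := by exact_mod_cast Finset.card_pos.2 ⟨g, hg⟩
        rw [Real.log_mul (by positivity) (walkWeight_pos hφ hωpos _ _ _).ne', Real.log_inv]
      have h8 := hlogφ g hg
      have h9 : 0 ≤ (n * Real.log k + β * N) *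
          Bᶜ.indicator (1 : X → ℝ) (T^[0] (proj (g * unip v * p))) :=
        mul_nonneg (by positivity) (hind _ _)
      have h10 : (n : ℝ) * (2 * e) = n * (ε / 2) := by rw [he]; ring
      rw [← hb] at h1
      linarith
    -- Off `B` the uniform code is used. The bound also subtracts a saving that this code does not
    -- achieve; it is at most `β * N`, and the last term gives it back.
    · have h1 := neg_log_mixture_le_uniform guess hk he0 (by linarith) (fun c => (hQpos c).le)
        (itinerary T ξ n y)
      have h2 : ∑ j ∈ Finset.range N, Kᶜ.indicator (1 : X → ℝ) (T^[t * j] y) ≤ N := by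
        calc _ ≤ ∑ j ∈ Finset.range N, (1 : ℝ) :=
              Finset.sum_le_sum fun j _ => Set.indicator_le_self' (fun _ _ => zero_le_one) _
          _ = N := by simp
      have h3 := mul_le_mul_of_nonneg_left h2 hβ
      have h4 : Bᶜ.indicator (1 : X → ℝ) (T^[0] y) = 1 := Set.indicator_of_mem hy _
      rw [h4]
      have h5 : 0 ≤ N * R := by positivity
      have h6 : 0 ≤ (n : ℝ) * (ε / 2) := by positivity
      linarith
  have hi1 : Integrable (fun y => ∑ j ∈ Finset.range N, Kᶜ.indicator (1 : X → ℝ) (T^[t * j] y)) μ :=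
    integrable_finsetSum _ fun j _ => integrable_indicator_iterate hKm _
  have hi2 : Integrable (fun y => ∑ j ∈ Finset.range n, Bᶜ.indicator (1 : X → ℝ) (T^[j] y)) μ :=
    integrable_finsetSum _ fun j _ => integrable_indicator_iterate hBm _
  have hi3 : Integrable (fun y => Bᶜ.indicator (1 : X → ℝ) (T^[0] y)) μ :=
    integrable_indicator_iterate hBm 0
  have hi4 := (integrable_const (μ := μ) (A₀ + N * R)).sub (hi1.const_mul β)
  have hi5 := hi4.add (integrable_const (n * (ε / 2)))
  have hi6 := hi5.add (hi2.const_mul b)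
  have hi7 := hi6.add (hi3.const_mul (n * Real.log k + β * N))
  have hmain := partitionEntropy_le_integral
    (measurable_itinerary (T := T) continuous_T.measurable hξ n)
    (mixture_pos guess hk he0 (by linarith) fun c => (hQpos c).le)
    (sum_mixture_le guess hk hQsum) hi7 hbound
  have hint := integral_add' hi6 (hi3.const_mul (n * Real.log k + β * N))
  rw [integral_add' hi5 (hi2.const_mul b), integral_add' hi4 (integrable_const _),
    integral_sub' (integrable_const _) (hi1.const_mul β), integral_const_mul, integral_const_mul,
    integral_const_mul, integral_finsetSum _ fun j _ => integrable_indicator_iterate hKm _,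
    integral_finsetSum _ fun j _ => integrable_indicator_iterate hBm _] at hint
  simp only [integral_const_mul, integral_indicator_iterate hT hKm, integral_indicator_iterate hT hBm,
    integral_const, probReal_univ, one_smul, Finset.sum_const, Finset.card_range,
    nsmul_eq_mul, hcompl] at hint
  refine (hmain.trans_eq hint).trans ?_
  exact mean_code_length_le (s := (s : ℝ)) N.cast_nonneg n.cast_nonneg ht'.le (by exact_mod_cast hN2) hm0 hm1
    measureReal_nonneg hCμ hb0 hlogk hβ2 hR hβ1 hε.le hδ1

end EntropyBound

/-! ### Shortest vectors of a lattice and of its dual. -/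

section Systole

open Matrix

/-- The real vector with the given integer coordinates. -/
def intVec (m : Fin 3 → ℤ) : Fin 3 → ℝ := fun i => m i

lemma norm_intVec (m : Fin 3 → ℤ) : ‖intVec m‖ = ‖m‖ := by
  simp [intVec, Pi.norm_def, ← Int.norm_cast_real, nnnorm]

lemma intVec_ne_zero {m : Fin 3 → ℤ} (hm : m ≠ 0) : intVec m ≠ 0 := by
  rw [← norm_ne_zero_iff, norm_intVec, norm_ne_zero_iff]
  exact hm

lemma norm_vecMul_le {h : Matrix (Fin 3) (Fin 3) ℝ} {C : ℝ} (hC : ∀ i j, |h i j| ≤ C)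
    (v : Fin 3 → ℝ) : ‖v ᵥ* h‖ ≤ 3 * C * ‖v‖ := by
  have hC0 : 0 ≤ C := (abs_nonneg _).trans (hC 0 0)
  refine (pi_norm_le_iff_of_nonneg (by positivity)).2 fun j => ?_
  rw [vecMul, dotProduct, Fin.sum_univ_three, Real.norm_eq_abs]
  have key : ∀ i, |v i * h i j| ≤ ‖v‖ * C := fun i => by
    rw [abs_mul]
    exact mul_le_mul (norm_le_pi_norm v i) (hC i j) (abs_nonneg _) (norm_nonneg _)
  have h0 := key 0
  have h1 := key 1
  have h2 := key 2
  have h3 := abs_add_le (v 0 * h 0 j + v 1 * h 1 j) (v 2 * h 2 j)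
  have h4 := abs_add_le (v 0 * h 0 j) (v 1 * h 1 j)
  linarith

lemma exists_entry_bound (h : Matrix (Fin 3) (Fin 3) ℝ) : ∃ C, ∀ i j, |h i j| ≤ C := by
  obtain ⟨C, hC⟩ := (Set.finite_range fun p : Fin 3 × Fin 3 => |h p.1 p.2|).bddAbove
  exact ⟨C, fun i j => hC ⟨(i, j), rfl⟩⟩

lemma exists_norm_le_vecMul {h : Matrix (Fin 3) (Fin 3) ℝ} (hh : h.det = 1) :
    ∃ C, 0 ≤ C ∧ ∀ v : Fin 3 → ℝ, ‖v‖ ≤ C * ‖v ᵥ* h‖ := by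
  obtain ⟨C, hC⟩ := exists_entry_bound h⁻¹
  have hC0 : 0 ≤ C := (abs_nonneg _).trans (hC 0 0)
  refine ⟨3 * C, by positivity, fun v => ?_⟩
  have := norm_vecMul_le hC (v ᵥ* h)
  rwa [vecMul_vecMul, Matrix.mul_nonsing_inv _ (by simp [hh]), vecMul_one] at this

lemma finite_norm_vecMul_le {h : Matrix (Fin 3) (Fin 3) ℝ} (hh : h.det = 1) (R : ℝ) :
    {m : Fin 3 → ℤ | ‖intVec m ᵥ* h‖ ≤ R}.Finite := by
  obtain ⟨C, hC0, hC⟩ := exists_norm_le_vecMul hh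
  refine ((isCompact_closedBall (0 : Fin 3 → ℤ) (C * R)).finite_of_discrete).subset fun m hm => ?_
  rw [mem_closedBall_zero_iff, ← norm_intVec]
  exact (hC _).trans (mul_le_mul_of_nonneg_left hm hC0)

/-- The length, in the supremum norm, of the shortest nonzero vector of the lattice spanned by the
rows of `h`. -/
noncomputable def systole (h : Matrix (Fin 3) (Fin 3) ℝ) : ℝ :=
  ⨅ m : {m : Fin 3 → ℤ // m ≠ 0}, ‖intVec m ᵥ* h‖

lemma systole_le (h : Matrix (Fin 3) (Fin 3) ℝ) {m : Fin 3 → ℤ} (hm : m ≠ 0) :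
    systole h ≤ ‖intVec m ᵥ* h‖ :=
  ciInf_le ⟨0, by rintro _ ⟨m, rfl⟩; exact norm_nonneg _⟩ (⟨m, hm⟩ : {m : Fin 3 → ℤ // m ≠ 0})

lemma exists_systole_eq {h : Matrix (Fin 3) (Fin 3) ℝ} (hh : h.det = 1) :
    ∃ m : Fin 3 → ℤ, m ≠ 0 ∧ systole h = ‖intVec m ᵥ* h‖ := by
  have h1 : (1 : Fin 3 → ℤ) ≠ 0 := one_ne_zero
  set R := ‖intVec 1 ᵥ* h‖
  have hfin : {m : Fin 3 → ℤ | m ≠ 0 ∧ ‖intVec m ᵥ* h‖ ≤ R}.Finite :=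
    (finite_norm_vecMul_le hh R).subset fun m hm => hm.2
  obtain ⟨m, hm, hmin⟩ := Set.exists_min_image _ (fun m => ‖intVec m ᵥ* h‖) hfin ⟨1, h1, le_rfl⟩
  refine ⟨m, hm.1, le_antisymm (systole_le h hm.1) ?_⟩
  have : Nonempty {m : Fin 3 → ℤ // m ≠ 0} := ⟨⟨1, h1⟩⟩
  refine le_ciInf fun m' => ?_
  by_cases hR : ‖intVec m' ᵥ* h‖ ≤ R
  · exact hmin _ ⟨m'.2, hR⟩
  · exact hm.2.trans (not_le.1 hR).le

lemma systole_pos {h : Matrix (Fin 3) (Fin 3) ℝ} (hh : h.det = 1) : 0 < systole h := by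
  obtain ⟨m, hm, hs⟩ := exists_systole_eq hh
  obtain ⟨C, hC0, hC⟩ := exists_norm_le_vecMul hh
  have h1 : 0 < ‖intVec m‖ := norm_pos_iff.2 (intVec_ne_zero hm)
  rw [hs]
  by_contra hneg
  have := hC (intVec m)
  nlinarith

/-- The cofactor matrix; for `h` of determinant one, its rows span the dual lattice. -/
def dual (h : Matrix (Fin 3) (Fin 3) ℝ) : Matrix (Fin 3) (Fin 3) ℝ := (adjugate h)ᵀ

lemma dual_mul (h k : Matrix (Fin 3) (Fin 3) ℝ) : dual (h * k) = dual h * dual k := by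
  rw [dual, adjugate_mul_distrib, transpose_mul, dual, dual]

lemma det_dual {h : Matrix (Fin 3) (Fin 3) ℝ} (hh : h.det = 1) : (dual h).det = 1 := by
  rw [dual, det_transpose, det_adjugate, hh, one_pow]

lemma dual_dual {h : Matrix (Fin 3) (Fin 3) ℝ} (hh : h.det = 1) : dual (dual h) = h := by
  rw [dual, dual, adjugate_transpose, transpose_transpose, adjugate_adjugate _ (by simp), hh]
  simp

/-- With `intVec_cross`, this turns two independent lattice vectors into a nonzero vector of the
dual lattice. -/
lemma vecMul_cross_vecMul (h : Matrix (Fin 3) (Fin 3) ℝ) (v w : Fin 3 → ℝ) :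
    (v ᵥ* h) ⨯₃ (w ᵥ* h) = (v ⨯₃ w) ᵥ* dual h := by
  rw [dual, adjugate_fin_three, cross_apply, cross_apply]
  ext i
  fin_cases i <;> simp [vecMul, dotProduct, Fin.sum_univ_three] <;> ring

lemma norm_cross_le (v w : Fin 3 → ℝ) : ‖v ⨯₃ w‖ ≤ 2 * (‖v‖ * ‖w‖) := by
  have key : ∀ i j k l : Fin 3, |v i * w j - v k * w l| ≤ 2 * (‖v‖ * ‖w‖) := by
    intro i j k l
    have h : ∀ i j, |v i * w j| ≤ ‖v‖ * ‖w‖ := fun i j => by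
      rw [abs_mul]
      exact mul_le_mul (norm_le_pi_norm v i) (norm_le_pi_norm w j) (abs_nonneg _) (norm_nonneg _)
    have := abs_sub (v i * w j) (v k * w l)
    linarith [h i j, h k l]
  refine (pi_norm_le_iff_of_nonneg (by positivity)).2 fun i => ?_
  rw [cross_apply, Real.norm_eq_abs]
  fin_cases i
  · exact key 1 2 2 1
  · exact key 2 0 0 2
  · exact key 0 1 1 0

lemma intVec_cross (m m' : Fin 3 → ℤ) : intVec m ⨯₃ intVec m' = intVec (m ⨯₃ m') := by
  rw [cross_apply, cross_apply]
  ext i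
  fin_cases i <;> simp [intVec]

lemma exists_smul_of_cross_eq_zero {m m' : Fin 3 → ℤ} (hm : m ≠ 0) (h : m ⨯₃ m' = 0) :
    ∃ q : ℝ, intVec m' = q • intVec m := by
  rw [cross_apply] at h
  have h0 : (m 1 : ℝ) * m' 2 - m 2 * m' 1 = 0 := by exact_mod_cast congrFun h 0
  have h1 : (m 2 : ℝ) * m' 0 - m 0 * m' 2 = 0 := by exact_mod_cast congrFun h 1
  have h2 : (m 0 : ℝ) * m' 1 - m 1 * m' 0 = 0 := by exact_mod_cast congrFun h 2
  obtain ⟨i, hi⟩ := Function.ne_iff.1 hm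
  have hi' : (m i : ℝ) ≠ 0 := by exact_mod_cast hi
  refine ⟨m' i / m i, ?_⟩
  ext j
  simp only [intVec, Pi.smul_apply, smul_eq_mul]
  field_simp
  fin_cases i <;> fin_cases j <;> simp at * <;> linarith

lemma systole_le_mul_systole_mul {h e : Matrix (Fin 3) (Fin 3) ℝ} (hh : h.det = 1) (he : e.det = 1)
    {A : ℝ} (heA : ∀ v : Fin 3 → ℝ, ‖v‖ ≤ A * ‖v ᵥ* e‖) :
    systole h ≤ A * systole (h * e) := by
  obtain ⟨m, hm, hs⟩ := exists_systole_eq (h := h * e) (by rw [det_mul, hh, he, one_mul])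
  rw [hs, ← vecMul_vecMul]
  exact (systole_le h hm).trans (heA _)

/-- Either one shortest vector controls the systole after multiplication by any matrix of `E`, or
there are two independent short vectors, and hence a short dual vector. -/
lemma systole_dichotomy {h : Matrix (Fin 3) (Fin 3) ℝ} (hh : h.det = 1)
    {E : Set (Matrix (Fin 3) (Fin 3) ℝ)} {A : ℝ} (hA : 0 ≤ A)
    (hE : ∀ e ∈ E, e.det = 1 ∧ ∀ v : Fin 3 → ℝ, ‖v ᵥ* e‖ ≤ A * ‖v‖ ∧ ‖v‖ ≤ A * ‖v ᵥ* e‖) :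
    (∃ w : Fin 3 → ℝ, ‖w‖ = systole h ∧ ∀ e ∈ E, ‖w ᵥ* e‖ ≤ systole (h * e)) ∨
      systole (dual h) ≤ 2 * A ^ 2 * systole h ^ 2 := by
  obtain ⟨m, hm, hs⟩ := exists_systole_eq hh
  have hpos := systole_pos hh
  -- The image of `m` has length at most `A * systole h`; any vector whose image is at least as
  -- short had length at most `A ^ 2 * systole h` before.
  by_cases hex : ∃ m' : Fin 3 → ℤ, m ⨯₃ m' ≠ 0 ∧ ‖intVec m' ᵥ* h‖ ≤ A ^ 2 * systole h
  · right
    obtain ⟨m', hcross, hle⟩ := hex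
    have h1 := systole_le (dual h) hcross
    rw [← intVec_cross, ← vecMul_cross_vecMul] at h1
    calc systole (dual h) ≤ 2 * (‖intVec m ᵥ* h‖ * ‖intVec m' ᵥ* h‖) := h1.trans (norm_cross_le _ _)
      _ ≤ 2 * (systole h * (A ^ 2 * systole h)) := by rw [← hs]; gcongr
      _ = 2 * A ^ 2 * systole h ^ 2 := by ring
  · left
    push Not at hex
    refine ⟨intVec m ᵥ* h, hs.symm, fun e he => ?_⟩
    obtain ⟨hdet, hv⟩ := hE e he
    obtain ⟨m', hm', hs'⟩ := exists_systole_eq (h := h * e) (by rw [det_mul, hh, hdet, one_mul])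
    rw [hs', ← vecMul_vecMul]
    by_cases hc : m ⨯₃ m' = 0
    -- A parallel lattice vector is no shorter than the minimal one, so |q| ≥ 1, and this persists
    -- under every matrix.
    · obtain ⟨q, hq⟩ := exists_smul_of_cross_eq_zero hm hc
      have h1 := systole_le h hm'
      rw [hs, hq, smul_vecMul, norm_smul] at h1
      rw [hq, smul_vecMul, smul_vecMul, norm_smul]
      have h2 : 1 ≤ ‖q‖ := by
        rw [← hs] at h1
        by_contra hlt
        nlinarith
      exact le_mul_of_one_le_left (norm_nonneg _) h2
    · have h1 := hex m' hc
      have h2 := (hv (intVec m ᵥ* h)).1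
      have h3 := (hv (intVec m' ᵥ* h)).2
      rw [← hs] at h2
      by_contra hlt
      have hlt' := not_le.1 hlt
      rcases hA.eq_or_lt with rfl | hA
      · have := norm_nonneg (intVec m' ᵥ* h ᵥ* e)
        linarith
      · have : A * ‖intVec m' ᵥ* h ᵥ* e‖ < A * (A * systole h) :=
          mul_lt_mul_of_pos_left (hlt'.trans_le h2) hA
        nlinarith

end Systole

/-! ### Harmonic sums and the matrices of the steps. -/

section Averages

open Matrix

/-- In the application `l` is `round (-c)` clamped to the range of summation, so that distances to
`l` can be counted inside this range. -/
lemma inv_max_abs_le (c : ℝ) (k l : ℤ) (h : |(k : ℝ) - l| ≤ |(k : ℝ) - round (-c)|) :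
    (max |c + k| 1)⁻¹ ≤ 2 * (((k - l).natAbs : ℝ) + 1)⁻¹ := by
  have h1 := abs_sub_round (-c)
  have h2 : |(k : ℝ) - round (-c)| ≤ |c + k| + 1 / 2 := by
    calc |(k : ℝ) - round (-c)| = |(c + k) + (-c - round (-c))| := by ring_nf
      _ ≤ _ := (abs_add_le _ _).trans (by linarith)
  have h3 : (((k - l).natAbs : ℕ) : ℝ) = |(k : ℝ) - l| := by
    rw [Nat.cast_natAbs]
    push_cast
    rfl
  have h4 : (((k - l).natAbs : ℝ) + 1) / 2 ≤ max |c + k| 1 := by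
    by_cases hn : (k - l).natAbs ≤ 1
    · have : ((k - l).natAbs : ℝ) ≤ 1 := by exact_mod_cast hn
      exact le_trans (by linarith) (le_max_right _ _)
    · have : (2 : ℝ) ≤ (k - l).natAbs := by exact_mod_cast (by omega : 2 ≤ (k - l).natAbs)
      exact le_trans (by linarith) (le_max_left _ _)
  calc (max |c + k| 1)⁻¹ ≤ ((((k - l).natAbs : ℝ) + 1) / 2)⁻¹ := by gcongr
    _ = _ := by rw [inv_div, div_eq_mul_inv]

/-- The bound for sums of `1 / max |c + k| 1` over `|k| ≤ L`. -/
noncomputable def logBound (L : ℕ) : ℝ := 4 * (1 + Real.log (2 * L + 1))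

lemma four_le_logBound (L : ℕ) : 4 ≤ logBound L := by
  have : 0 ≤ Real.log (2 * L + 1) := Real.log_nonneg (by linarith [L.cast_nonneg (α := ℝ)])
  unfold logBound
  linarith

/-- Each distance to the clamped centre `l` occurs at most twice, which leaves four times a harmonic
sum, uniformly in `c`. -/
lemma sum_inv_max_abs_le (L : ℕ) (c : ℝ) :
    ∑ k : ↥(Finset.Icc (-(L : ℤ)) L), (max |c + ((k : ℤ) : ℝ)| 1)⁻¹ ≤ logBound L := by
  set l : ℤ := max (-(L : ℤ)) (min L (round (-c))) with hl
  have hlm : -(L : ℤ) ≤ l ∧ l ≤ L := by omega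
  rw [Finset.sum_coe_sort (Finset.Icc (-(L : ℤ)) L) fun k : ℤ => (max |c + (k : ℝ)| 1)⁻¹]
  calc ∑ k ∈ Finset.Icc (-(L : ℤ)) L, (max |c + (k : ℝ)| 1)⁻¹
      ≤ ∑ k ∈ Finset.Icc (-(L : ℤ)) L, 2 * (((k - l).natAbs : ℝ) + 1)⁻¹ := by
        refine Finset.sum_le_sum fun k hk => inv_max_abs_le c k l ?_
        rw [Finset.mem_Icc] at hk
        have : |k - l| ≤ |k - round (-c)| := by
          rw [Int.abs_eq_natAbs, Int.abs_eq_natAbs]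
          omega
        exact_mod_cast this
    _ = 2 * ∑ j ∈ (Finset.Icc (-(L : ℤ)) L).image (fun k => (k - l).natAbs),
          ((Finset.Icc (-(L : ℤ)) L).filter fun k => (k - l).natAbs = j).card • ((j : ℝ) + 1)⁻¹ := by
        rw [← Finset.mul_sum, Finset.sum_comp (fun j : ℕ => ((j : ℝ) + 1)⁻¹)]
    _ ≤ 2 * ∑ j ∈ (Finset.Icc (-(L : ℤ)) L).image (fun k => (k - l).natAbs),
          2 * ((j : ℝ) + 1)⁻¹ := by
        gcongr with j hj
        rw [nsmul_eq_mul]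
        gcongr
        have hsub : ((Finset.Icc (-(L : ℤ)) L).filter fun k => (k - l).natAbs = j) ⊆
            {l + j, l - j} := by
          intro k hk
          simp only [Finset.mem_filter, Finset.mem_insert, Finset.mem_singleton] at hk ⊢
          omega
        exact_mod_cast (Finset.card_le_card hsub).trans Finset.card_le_two
    _ ≤ 2 * ∑ j ∈ Finset.range (2 * L + 1), 2 * ((j : ℝ) + 1)⁻¹ := by
        refine mul_le_mul_of_nonneg_left (Finset.sum_le_sum_of_subset_of_nonneg ?_ ?_) (by norm_num)
        · intro j hj
          simp only [Finset.mem_image, Finset.mem_Icc, Finset.mem_range] at hj ⊢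
          omega
        · intros
          positivity
    _ = 4 * (harmonic (2 * L + 1) : ℝ) := by
        rw [harmonic, ← Finset.mul_sum]
        push_cast
        ring
    _ ≤ logBound L := by
        have := harmonic_le_one_add_log (2 * L + 1)
        push_cast at this
        unfold logBound
        linarith

variable {t L : ℕ}

variable (t) in
/-- The matrices of the steps of the walk. -/
noncomputable def stepMat (d : Digit L) : Matrix (Fin 3) (Fin 3) ℝ :=
  (unip (gridPt d) : Matrix (Fin 3) (Fin 3) ℝ) * ((α ^ t : G) : Matrix (Fin 3) (Fin 3) ℝ)

lemma coe_step (x : G) (d : Digit L) :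
    (step t x d : Matrix (Fin 3) (Fin 3) ℝ) = (x : Matrix (Fin 3) (Fin 3) ℝ) * stepMat t d := by
  rw [step, mul_assoc, Matrix.SpecialLinearGroup.coe_mul, Matrix.SpecialLinearGroup.coe_mul, stepMat]

lemma det_stepMat (d : Digit L) : (stepMat t d).det = 1 := (unip (gridPt d) * α ^ t).2

lemma vecMul_stepMat (d : Digit L) (v : Fin 3 → ℝ) : v ᵥ* stepMat t d =
    ![Real.exp (t / 2) * (v 0 + v 2 * (gridPt d).1), Real.exp (t / 2) * (v 1 + v 2 * (gridPt d).2),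
      Real.exp (-t) * v 2] := by
  rw [stepMat, coe_α_pow, coe_unip, ← vecMul_vecMul]
  ext i
  rw [vecMul_diagonal]
  fin_cases i <;> simp [vecMul, dotProduct, Fin.sum_univ_three, weight] <;> ring_nf

lemma vecMul_dual_stepMat (d : Digit L) (v : Fin 3 → ℝ) : v ᵥ* dual (stepMat t d) =
    ![Real.exp (-(t / 2)) * v 0, Real.exp (-(t / 2)) * v 1,
      Real.exp t * (v 2 - v 0 * (gridPt d).1 - v 1 * (gridPt d).2)] := by
  have hα : dual ((α ^ t : G) : Matrix (Fin 3) (Fin 3) ℝ) =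
      diagonal fun i => Real.exp (-(t * weight i)) := by
    have h := coe_inv_α_pow t
    rw [Matrix.SpecialLinearGroup.coe_inv] at h
    rw [dual, h, diagonal_transpose]
  rw [stepMat, dual_mul, hα, ← vecMul_vecMul, coe_unip, dual,
    adjugate_fin_three]
  ext i
  rw [vecMul_diagonal]
  fin_cases i <;> simp [vecMul, dotProduct, Fin.sum_univ_three, weight] <;> ring_nf

end Averages

/-! ### Contraction of inverse lengths of single vectors. -/

section Averages

open Matrix

variable {t L : ℕ}

lemma abs_gridPt_fst_le (d : Digit L) : |(gridPt d).1| ≤ 1 :=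
  (le_max_left _ _).trans (norm_gridPt_le d)

lemma abs_gridPt_snd_le (d : Digit L) : |(gridPt d).2| ≤ 1 :=
  (le_max_right _ _).trans (norm_gridPt_le d)

lemma exists_norm_eq_abs (w : Fin 3 → ℝ) : ∃ i, ‖w‖ = |w i| := by
  obtain ⟨i, hi⟩ := Finite.exists_max fun i => |w i|
  exact ⟨i, le_antisymm ((pi_norm_le_iff_of_nonneg (abs_nonneg _)).2 hi) (norm_le_pi_norm w i)⟩

lemma norm_vec_le {a b c r : ℝ} (ha : |a| ≤ r) (hb : |b| ≤ r) (hc : |c| ≤ r) :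
    ‖![a, b, c]‖ ≤ r := by
  refine (pi_norm_le_iff_of_nonneg ((abs_nonneg _).trans ha)).2 fun i => ?_
  fin_cases i
  · exact ha
  · exact hb
  · exact hc

/-- The contraction rate of the averages of the height functions. -/
noncomputable def rate (t L : ℕ) : ℝ := logBound L ^ 2 * Real.exp (-t)

lemma rate_pos (t L : ℕ) : 0 < rate t L := by
  have := four_le_logBound L
  unfold rate
  positivity

lemma exp_half_scale (hL : Real.exp (3 * t / 2) ≤ L) : Real.exp (t / 2) ≤ L * Real.exp (-t) := by
  calc Real.exp (t / 2) = Real.exp (3 * t / 2) * Real.exp (-t) := by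
        rw [← Real.exp_add]
        ring_nf
    _ ≤ _ := by gcongr

lemma cast_card_digit : (Fintype.card (Digit L) : ℝ) = (2 * L + 1) ^ 2 := by
  rw [card_digit]
  push_cast
  rfl

/-- The average of `‖w u a‖⁻²` over the steps of the walk. -/
lemma sum_inv_sq_norm_le (hL : Real.exp (3 * t / 2) ≤ L) {w : Fin 3 → ℝ} (hw : w ≠ 0) :
    ∑ d : Digit L, (‖w ᵥ* stepMat t d‖ ^ 2)⁻¹ ≤
      Fintype.card (Digit L) * (rate t L * (‖w‖ ^ 2)⁻¹) := by
  have hL0 : (0 : ℝ) < L := (Real.exp_pos _).trans_le hL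
  have hS := four_le_logBound L
  have hw0 : 0 < ‖w‖ := norm_pos_iff.2 hw
  have hcoord : ∀ d : Digit L,
      Real.exp (t / 2) * |w 0 + w 2 * (gridPt d).1| ≤ ‖w ᵥ* stepMat t d‖ ∧
      Real.exp (t / 2) * |w 1 + w 2 * (gridPt d).2| ≤ ‖w ᵥ* stepMat t d‖ ∧
      Real.exp (-t) * |w 2| ≤ ‖w ᵥ* stepMat t d‖ := by
    intro d
    have h := norm_le_pi_norm (w ᵥ* stepMat t d)
    have h0 := h 0
    have h1 := h 1
    have h2 := h 2
    rw [Real.norm_eq_abs] at h0 h1 h2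
    rw [vecMul_stepMat] at h0 h1 h2 ⊢
    refine ⟨le_trans (le_of_eq ?_) h0, le_trans (le_of_eq ?_) h1, le_trans (le_of_eq ?_) h2⟩ <;>
    simp [abs_mul]
  by_cases hcase : ‖w‖ ≤ 2 * |w 2|
  · have hw2 : 0 < |w 2| := by linarith
    have hw2' : w 2 ≠ 0 := abs_pos.1 hw2
    -- `ρ` is the spacing of the first two image coordinates as their digits vary. Since L ≥
    -- e^{3t/2}, it is at most the third coordinate in absolute value, which bounds the norm below
    -- when the others nearly vanish.
    set ρ : ℝ := Real.exp (t / 2) * |w 2| / L with hρ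
    have hρ0 : 0 < ρ := by positivity
    have hρ1 : ρ ≤ Real.exp (-t) * |w 2| := by
      rw [hρ, div_le_iff₀ hL0]
      have := mul_le_mul_of_nonneg_right (exp_half_scale hL) hw2.le
      linarith
    have hlow : ∀ (a : ℝ) (k : ℤ),
        ρ * |L * a / w 2 + k| = Real.exp (t / 2) * |a + w 2 * (k / L)| := by
      intro a k
      rw [show a + w 2 * (k / L) = w 2 / L * (L * a / w 2 + k) by field_simp, abs_mul, abs_div,
        Nat.abs_cast, hρ]
      ring
    set f : ℝ → ↥(Finset.Icc (-(L : ℤ)) L) → ℝ :=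
      fun a k => (max |L * a / w 2 + ((k : ℤ) : ℝ)| 1)⁻¹ with hf
    -- One factor of the squared norm is bounded below by each horizontal coordinate, so the double
    -- sum splits into two harmonic sums; hence the square of `logBound` in `rate`.
    have hterm : ∀ d : Digit L, (‖w ᵥ* stepMat t d‖ ^ 2)⁻¹ ≤
        (ρ ^ 2)⁻¹ * (f (w 0) d.1 * f (w 1) d.2) := by
      intro d
      obtain ⟨h0, h1, h2⟩ := hcoord d
      rw [hf]
      dsimp only
      rw [← mul_inv, ← mul_inv]
      have e0 : ρ * max |L * w 0 / w 2 + ((d.1 : ℤ) : ℝ)| 1 ≤ ‖w ᵥ* stepMat t d‖ := by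
        rw [mul_max_of_nonneg _ _ hρ0.le, hlow, mul_one]
        exact max_le h0 (hρ1.trans h2)
      have e1 : ρ * max |L * w 1 / w 2 + ((d.2 : ℤ) : ℝ)| 1 ≤ ‖w ᵥ* stepMat t d‖ := by
        rw [mul_max_of_nonneg _ _ hρ0.le, hlow, mul_one]
        exact max_le h1 (hρ1.trans h2)
      refine inv_anti₀ (by positivity) ?_
      calc _ = (ρ * max |L * w 0 / w 2 + ((d.1 : ℤ) : ℝ)| 1) *
            (ρ * max |L * w 1 / w 2 + ((d.2 : ℤ) : ℝ)| 1) := by ring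
        _ ≤ ‖w ᵥ* stepMat t d‖ * ‖w ᵥ* stepMat t d‖ := by gcongr
        _ = _ := by ring
    have hfsum : ∀ a, ∑ k, f a k ≤ logBound L := fun a => sum_inv_max_abs_le L _
    have hf0 : ∀ a, 0 ≤ ∑ k, f a k := fun a => Finset.sum_nonneg fun k _ => by positivity
    have hρinv : (ρ ^ 2)⁻¹ ≤ (2 * L + 1) ^ 2 * (Real.exp (-t) * (‖w‖ ^ 2)⁻¹) := by
      have h1 : ρ ^ 2 = Real.exp t * |w 2| ^ 2 / L ^ 2 := by
        rw [hρ, div_pow, mul_pow, ← Real.exp_nat_mul]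
        push_cast
        rw [mul_div_cancel₀ _ (two_ne_zero)]
      rw [h1, inv_div, Real.exp_neg, div_eq_mul_inv, mul_inv]
      have h2 : (|w 2| ^ 2)⁻¹ ≤ 4 * (‖w‖ ^ 2)⁻¹ := by
        rw [← div_eq_mul_inv, inv_le_comm₀ (by positivity) (by positivity), inv_div]
        rw [div_le_iff₀ (by norm_num)]
        nlinarith
      calc (L : ℝ) ^ 2 * ((Real.exp t)⁻¹ * (|w 2| ^ 2)⁻¹)
          ≤ (L : ℝ) ^ 2 * ((Real.exp t)⁻¹ * (4 * (‖w‖ ^ 2)⁻¹)) := by gcongr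
        _ = (2 * L) ^ 2 * ((Real.exp t)⁻¹ * (‖w‖ ^ 2)⁻¹) := by ring
        _ ≤ _ := by
            gcongr
            linarith
    calc ∑ d : Digit L, (‖w ᵥ* stepMat t d‖ ^ 2)⁻¹
        ≤ ∑ d : Digit L, (ρ ^ 2)⁻¹ * (f (w 0) d.1 * f (w 1) d.2) :=
          Finset.sum_le_sum fun d _ => hterm d
      _ = (ρ ^ 2)⁻¹ * ((∑ k, f (w 0) k) * ∑ k, f (w 1) k) := by
          rw [← Finset.mul_sum, Finset.sum_mul_sum, ← Fintype.sum_prod_type']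
      _ ≤ (2 * L + 1) ^ 2 * (Real.exp (-t) * (‖w‖ ^ 2)⁻¹) * (logBound L * logBound L) := by
          exact mul_le_mul hρinv (mul_le_mul (hfsum _) (hfsum _) (hf0 _) (by linarith))
            (mul_nonneg (hf0 _) (hf0 _)) (by positivity)
      _ = _ := by
          rw [cast_card_digit, rate]
          ring
  -- Now coordinate 0 or 1 realises the norm, a displacement cancels at most half of it, and the
  -- flow expands it by e^{t/2}.
  · have hcase' := not_le.1 hcase
    have hterm : ∀ d : Digit L, (‖w ᵥ* stepMat t d‖ ^ 2)⁻¹ ≤ rate t L * (‖w‖ ^ 2)⁻¹ := by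
      intro d
      have hlow : ∀ a b : ℝ, ‖w‖ = |a| → |b| ≤ 1 → ‖w‖ / 2 ≤ |a + w 2 * b| := by
        intro a b ha hb
        have h1 := abs_sub_abs_le_abs_sub a (-(w 2 * b))
        rw [sub_neg_eq_add, abs_neg, abs_mul] at h1
        nlinarith [abs_nonneg (w 2)]
      have hmain : Real.exp (t / 2) * (‖w‖ / 2) ≤ ‖w ᵥ* stepMat t d‖ := by
        obtain ⟨h0, h1, h2⟩ := hcoord d
        obtain ⟨i, hi⟩ := exists_norm_eq_abs w
        fin_cases i
        · exact (mul_le_mul_of_nonneg_left (hlow _ _ hi (abs_gridPt_fst_le d))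
            (Real.exp_pos _).le).trans h0
        · exact (mul_le_mul_of_nonneg_left (hlow _ _ hi (abs_gridPt_snd_le d))
            (Real.exp_pos _).le).trans h1
        · simp only [Fin.reduceFinMk] at hi
          linarith [abs_nonneg (w 2)]
      have h1 : (Real.exp (t / 2) * (‖w‖ / 2)) ^ 2 ≤ ‖w ᵥ* stepMat t d‖ ^ 2 := by gcongr
      have h2 : (Real.exp (t / 2) * (‖w‖ / 2)) ^ 2 = Real.exp t * ‖w‖ ^ 2 / 4 := by
        rw [mul_pow, ← Real.exp_nat_mul]
        push_cast
        rw [mul_div_cancel₀ _ (two_ne_zero)]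
        ring
      calc (‖w ᵥ* stepMat t d‖ ^ 2)⁻¹ ≤ (Real.exp t * ‖w‖ ^ 2 / 4)⁻¹ := by
            rw [← h2]
            gcongr
        _ = 4 * (Real.exp (-t) * (‖w‖ ^ 2)⁻¹) := by
            rw [Real.exp_neg]
            field_simp
        _ ≤ logBound L ^ 2 * (Real.exp (-t) * (‖w‖ ^ 2)⁻¹) := by
            gcongr
            nlinarith
        _ = _ := by rw [rate, mul_assoc]
    calc _ ≤ ∑ _d : Digit L, rate t L * (‖w‖ ^ 2)⁻¹ := Finset.sum_le_sum fun d _ => hterm d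
      _ = _ := by rw [Finset.sum_const, Finset.card_univ, nsmul_eq_mul]

/-- A sum over a square of inverse lengths, one of whose coordinates moves with slope `a / L`. -/
lemma sum_sum_inv_le {ι : Type*} [Fintype ι] {a E : ℝ} (ha : a ≠ 0) (hL : 0 < L) (hE : 0 < E)
    (c : ι → ℝ) {f : ι → ↥(Finset.Icc (-(L : ℤ)) L) → ℝ}
    (hf : ∀ i (k : ↥(Finset.Icc (-(L : ℤ)) L)), E * |c i - a * (((k : ℤ) : ℝ) / L)| ≤ f i k)
    (hf' : ∀ i k, E * |a| / L ≤ f i k) :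
    ∑ i, ∑ k, (f i k)⁻¹ ≤ Fintype.card ι * (L / (E * |a|) * logBound L) := by
  have hL0 : (0 : ℝ) < L := by exact_mod_cast hL
  have ha' : 0 < |a| := abs_pos.2 ha
  have hin : ∀ i, ∑ k, (f i k)⁻¹ ≤ L / (E * |a|) * logBound L := by
    intro i
    calc ∑ k, (f i k)⁻¹
        ≤ ∑ k : ↥(Finset.Icc (-(L : ℤ)) L),
            L / (E * |a|) * (max |-(L * c i / a) + ((k : ℤ) : ℝ)| 1)⁻¹ := by
          refine Finset.sum_le_sum fun k _ => ?_
          rw [← inv_div, ← mul_inv]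
          refine inv_anti₀ (by positivity) ?_
          rw [mul_max_of_nonneg _ _ (by positivity), mul_one]
          refine max_le (le_trans (le_of_eq ?_) (hf i k)) (hf' i k)
          rw [show c i - a * (((k : ℤ) : ℝ) / L) = -(a / L * (-(L * c i / a) + ((k : ℤ) : ℝ))) by
            field_simp; ring, abs_neg, abs_mul, abs_div, Nat.abs_cast]
          ring
      _ ≤ _ := by
          rw [← Finset.mul_sum]
          gcongr
          exact sum_inv_max_abs_le L _
  calc _ ≤ ∑ _i : ι, L / (E * |a|) * logBound L := Finset.sum_le_sum fun i _ => hin i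
    _ = _ := by rw [Finset.sum_const, Finset.card_univ, nsmul_eq_mul]

/-- The average of `‖w (u a)*‖⁻¹` over the steps of the walk, for the dual action. -/
lemma sum_inv_norm_dual_le (hL : Real.exp (3 * t / 2) ≤ L) {w : Fin 3 → ℝ} (hw : w ≠ 0) :
    ∑ d : Digit L, ‖w ᵥ* dual (stepMat t d)‖⁻¹ ≤
      Fintype.card (Digit L) * (rate t L * ‖w‖⁻¹) := by
  have hL0 : (0 : ℝ) < L := (Real.exp_pos _).trans_le hL
  have hL1 : 0 < L := by exact_mod_cast hL0
  have hS := four_le_logBound L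
  have hw0 : 0 < ‖w‖ := norm_pos_iff.2 hw
  have hcoord : ∀ d : Digit L,
      Real.exp (-(t / 2)) * |w 0| ≤ ‖w ᵥ* dual (stepMat t d)‖ ∧
      Real.exp (-(t / 2)) * |w 1| ≤ ‖w ᵥ* dual (stepMat t d)‖ ∧
      Real.exp t * |w 2 - w 0 * (gridPt d).1 - w 1 * (gridPt d).2| ≤
        ‖w ᵥ* dual (stepMat t d)‖ := by
    intro d
    have h := norm_le_pi_norm (w ᵥ* dual (stepMat t d))
    have h0 := h 0
    have h1 := h 1
    have h2 := h 2
    rw [Real.norm_eq_abs] at h0 h1 h2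
    rw [vecMul_dual_stepMat] at h0 h1 h2 ⊢
    refine ⟨le_trans (le_of_eq ?_) h0, le_trans (le_of_eq ?_) h1, le_trans (le_of_eq ?_) h2⟩ <;>
    simp [abs_mul]
  -- In the dual action only the last coordinate moves with the digits. Its spacing is at most the
  -- corresponding contracted coordinate, so one harmonic sum suffices.
  have hscale : ∀ a : ℝ, Real.exp t * |a| / L ≤ Real.exp (-(t / 2)) * |a| := by
    intro a
    rw [div_le_iff₀ hL0]
    have : Real.exp t = Real.exp (-(t / 2)) * Real.exp (3 * t / 2) := by
      rw [← Real.exp_add]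
      ring_nf
    rw [this]
    have := mul_le_mul_of_nonneg_left hL (mul_nonneg (Real.exp_pos (-(t / 2 : ℝ))).le (abs_nonneg a))
    linarith
  have hcard : (Fintype.card ↥(Finset.Icc (-(L : ℤ)) L) : ℝ) = 2 * L + 1 := by
    rw [Fintype.card_coe, Int.card_Icc]
    have : ((L : ℤ) + 1 - -(L : ℤ)).toNat = 2 * L + 1 := by omega
    rw [this]
    push_cast
    rfl
  have hfinal : ∀ a : ℝ, a ≠ 0 → ‖w‖ ≤ 4 * |a| →
      (2 * (L : ℝ) + 1) * (L / (Real.exp t * |a|) * logBound L) ≤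
        Fintype.card (Digit L) * (rate t L * ‖w‖⁻¹) := by
    intro a ha hwa
    have ha' : 0 < |a| := abs_pos.2 ha
    rw [cast_card_digit, rate, Real.exp_neg]
    calc (2 * (L : ℝ) + 1) * (L / (Real.exp t * |a|) * logBound L)
        = (2 * (L : ℝ) + 1) * L * logBound L * (Real.exp t)⁻¹ * |a|⁻¹ := by field_simp
      _ ≤ (2 * (L : ℝ) + 1) * L * logBound L * (Real.exp t)⁻¹ * (4 * ‖w‖⁻¹) := by
          gcongr
          rw [← div_eq_mul_inv, inv_le_comm₀ ha' (by positivity), inv_div]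
          linarith
      _ = (2 * (L : ℝ) + 1) * (4 * L) * logBound L * (Real.exp t)⁻¹ * ‖w‖⁻¹ := by ring
      _ ≤ (2 * (L : ℝ) + 1) * ((2 * L + 1) * logBound L) * logBound L * (Real.exp t)⁻¹ * ‖w‖⁻¹ := by
          have h4 : 4 * (L : ℝ) ≤ (2 * L + 1) * logBound L := by nlinarith
          have hS0 : 0 < logBound L := by linarith
          refine mul_le_mul_of_nonneg_right (mul_le_mul_of_nonneg_right (mul_le_mul_of_nonneg_right
            (mul_le_mul_of_nonneg_left h4 ?_) ?_) ?_) ?_ <;> positivity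
      _ = _ := by ring
  by_cases h0 : ‖w‖ ≤ 4 * |w 0|
  · have hw0' : w 0 ≠ 0 := abs_pos.1 (by linarith)
    rw [Fintype.sum_prod_type, Finset.sum_comm]
    refine (sum_sum_inv_le hw0' hL1 (Real.exp_pos t)
      (fun i : ↥(Finset.Icc (-(L : ℤ)) L) => w 2 - w 1 * (((i : ℤ) : ℝ) / L))
      (f := fun i k => ‖w ᵥ* dual (stepMat t (k, i))‖) ?_ ?_).trans ?_
    · intro i k
      refine le_trans (le_of_eq ?_) (hcoord (k, i)).2.2
      rw [gridPt, sub_right_comm]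
    · exact fun i k => (hscale _).trans (hcoord (k, i)).1
    · rw [hcard]
      exact hfinal _ hw0' h0
  by_cases h1 : ‖w‖ ≤ 4 * |w 1|
  · have hw1' : w 1 ≠ 0 := abs_pos.1 (by linarith)
    rw [Fintype.sum_prod_type]
    refine (sum_sum_inv_le hw1' hL1 (Real.exp_pos t)
      (fun i : ↥(Finset.Icc (-(L : ℤ)) L) => w 2 - w 0 * (((i : ℤ) : ℝ) / L))
      (f := fun i k => ‖w ᵥ* dual (stepMat t (i, k))‖) ?_ ?_).trans ?_
    · exact fun i k => (hcoord (i, k)).2.2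
    · exact fun i k => (hscale _).trans (hcoord (i, k)).2.1
    · rw [hcard]
      exact hfinal _ hw1' h1
  · have hterm : ∀ d : Digit L, ‖w ᵥ* dual (stepMat t d)‖⁻¹ ≤ rate t L * ‖w‖⁻¹ := by
      intro d
      have hw2 : ‖w‖ = |w 2| := by
        obtain ⟨i, hi⟩ := exists_norm_eq_abs w
        fin_cases i
        · simp only [Fin.zero_eta] at hi
          linarith [abs_nonneg (w 0)]
        · simp only [Fin.mk_one] at hi
          linarith [abs_nonneg (w 1)]
        · exact hi
      have hlow : ‖w‖ / 2 ≤ |w 2 - w 0 * (gridPt d).1 - w 1 * (gridPt d).2| := by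
        have e1 := abs_sub_abs_le_abs_sub (w 2) (w 0 * (gridPt d).1 + w 1 * (gridPt d).2)
        have e2 := abs_add_le (w 0 * (gridPt d).1) (w 1 * (gridPt d).2)
        rw [abs_mul, abs_mul] at e2
        have e3 := abs_gridPt_fst_le d
        have e4 := abs_gridPt_snd_le d
        rw [sub_sub]
        have e5 := mul_le_of_le_one_right (abs_nonneg (w 0)) e3
        have e6 := mul_le_of_le_one_right (abs_nonneg (w 1)) e4
        linarith
      have hmain : Real.exp t * (‖w‖ / 2) ≤ ‖w ᵥ* dual (stepMat t d)‖ :=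
        (mul_le_mul_of_nonneg_left hlow (Real.exp_pos _).le).trans (hcoord d).2.2
      calc ‖w ᵥ* dual (stepMat t d)‖⁻¹ ≤ (Real.exp t * (‖w‖ / 2))⁻¹ := by gcongr
        _ = 2 * (Real.exp (-t) * ‖w‖⁻¹) := by
            rw [Real.exp_neg]
            field_simp
        _ ≤ logBound L ^ 2 * (Real.exp (-t) * ‖w‖⁻¹) := by
            gcongr
            nlinarith
        _ = _ := by rw [rate, mul_assoc]
    calc _ ≤ ∑ _d : Digit L, rate t L * ‖w‖⁻¹ := Finset.sum_le_sum fun d _ => hterm d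
      _ = _ := by rw [Finset.sum_const, Finset.card_univ, nsmul_eq_mul]

end Averages

/-! ### Lattice reduction in rank three and Mahler's criterion. -/

section Reduction

open Matrix

/-- The square of the Euclidean norm. -/
def normSq (v : Fin 3 → ℝ) : ℝ := v ⬝ᵥ v

lemma normSq_eq (v : Fin 3 → ℝ) : normSq v = v 0 ^ 2 + v 1 ^ 2 + v 2 ^ 2 := by
  simp [normSq, dotProduct, Fin.sum_univ_three]
  ring

lemma normSq_nonneg (v : Fin 3 → ℝ) : 0 ≤ normSq v := by
  rw [normSq_eq]
  positivity

lemma sq_apply_le_normSq (v : Fin 3 → ℝ) (i : Fin 3) : v i ^ 2 ≤ normSq v := by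
  rw [normSq_eq]
  have := sq_nonneg (v 0)
  have := sq_nonneg (v 1)
  have := sq_nonneg (v 2)
  fin_cases i <;> simp <;> linarith

lemma sq_norm_le_normSq (v : Fin 3 → ℝ) : ‖v‖ ^ 2 ≤ normSq v := by
  have h : ‖v‖ ≤ √(normSq v) := (pi_norm_le_iff_of_nonneg (Real.sqrt_nonneg _)).2 fun i =>
    Real.abs_le_sqrt (sq_apply_le_normSq v i)
  calc ‖v‖ ^ 2 ≤ √(normSq v) ^ 2 := by gcongr
    _ = _ := Real.sq_sqrt (normSq_nonneg v)

/-- Reducing `q` modulo the multiples of `p`. -/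
lemma exists_int_reduce (p q : Fin 3 → ℝ) (hp : 0 < normSq p) :
    ∃ k : ℤ, normSq p * normSq (q + (k : ℝ) • p) ≤ normSq (p ⨯₃ q) + normSq p ^ 2 / 4 := by
  set x := -(p ⬝ᵥ q) / normSq p with hx
  refine ⟨round x, ?_⟩
  have h1 := abs_sub_round x
  -- Lagrange's identity |p|²|q'|² = |p × q'|² + (p · q')²; adding multiples of p to q does not
  -- change p × q.
  have hlag : normSq p * normSq (q + (round x : ℝ) • p) =
      normSq (p ⨯₃ q) + (p ⬝ᵥ q + round x * normSq p) ^ 2 := by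
    simp only [normSq_eq, cross_apply, dotProduct, Fin.sum_univ_three, Pi.add_apply,
      Pi.smul_apply, smul_eq_mul, cons_val_zero, cons_val_one, cons_val]
    ring
  have h2 : p ⬝ᵥ q + round x * normSq p = normSq p * (-(x - round x)) := by
    rw [hx]
    field_simp
    ring
  rw [hlag, h2, mul_pow, neg_sq]
  have h3 : (x - round x) ^ 2 ≤ (1 / 2) ^ 2 := sq_le_sq' (by linarith [abs_le.1 h1]) (abs_le.1 h1).2
  nlinarith [sq_nonneg (normSq p)]

/-- The rows of `γ g`. -/
def rowVec (γ : Matrix.SpecialLinearGroup (Fin 3) ℤ) (g : Matrix (Fin 3) (Fin 3) ℝ) (i : Fin 3) :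
    Fin 3 → ℝ :=
  intVec ((γ : Matrix (Fin 3) (Fin 3) ℤ) i) ᵥ* g

lemma rowVec_mul (E γ : Matrix.SpecialLinearGroup (Fin 3) ℤ) (g : Matrix (Fin 3) (Fin 3) ℝ) (i : Fin 3) :
    rowVec (E * γ) g i = (E i 0 : ℝ) • rowVec γ g 0 + (E i 1 : ℝ) • rowVec γ g 1 +
      (E i 2 : ℝ) • rowVec γ g 2 := by
  have h : intVec (((E * γ : Matrix.SpecialLinearGroup (Fin 3) ℤ) : Matrix (Fin 3) (Fin 3) ℤ) i) =
      (E i 0 : ℝ) • intVec ((γ : Matrix (Fin 3) (Fin 3) ℤ) 0) +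
      (E i 1 : ℝ) • intVec ((γ : Matrix (Fin 3) (Fin 3) ℤ) 1) +
      (E i 2 : ℝ) • intVec ((γ : Matrix (Fin 3) (Fin 3) ℤ) 2) := by
    ext j
    simp [intVec, Matrix.mul_apply, Fin.sum_univ_three]
  rw [rowVec, h, add_vecMul, add_vecMul, smul_vecMul, smul_vecMul, smul_vecMul]
  rfl

lemma coe_map_mul_apply (γ : Matrix.SpecialLinearGroup (Fin 3) ℤ) (g : G) (i j : Fin 3) :
    (Matrix.SpecialLinearGroup.map (Int.castRingHom ℝ) γ * g) i j =
      rowVec γ (g : Matrix (Fin 3) (Fin 3) ℝ) i j := by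
  rw [Matrix.SpecialLinearGroup.coe_mul]
  simp [Matrix.mul_apply, rowVec, vecMul, dotProduct, intVec]

/-- Exchange of the first two basis vectors. -/
def swapFst (k : ℤ) : Matrix.SpecialLinearGroup (Fin 3) ℤ :=
  ⟨!![k, 1, 0; -1, 0, 0; 0, 0, 1], by simp [det_fin_three]⟩

/-- Exchange of the last two basis vectors. -/
def swapLast (k : ℤ) : Matrix.SpecialLinearGroup (Fin 3) ℤ :=
  ⟨!![1, 0, 0; 0, k, 1; 0, -1, 0], by simp [det_fin_three]⟩

/-- Size reduction of a basis. -/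
def sizeReduction (k j l : ℤ) : Matrix.SpecialLinearGroup (Fin 3) ℤ :=
  ⟨!![1, 0, 0; k, 1, 0; j, l, 1], by simp [det_fin_three]⟩

lemma rowVec_swapFst (k : ℤ) (γ : Matrix.SpecialLinearGroup (Fin 3) ℤ)
    (g : Matrix (Fin 3) (Fin 3) ℝ) :
    rowVec (swapFst k * γ) g 0 = rowVec γ g 1 + (k : ℝ) • rowVec γ g 0 ∧
      rowVec (swapFst k * γ) g 1 = -rowVec γ g 0 := by
  rw [rowVec_mul, rowVec_mul]
  simp [swapFst, add_comm]

lemma rowVec_swapLast (k : ℤ) (γ : Matrix.SpecialLinearGroup (Fin 3) ℤ)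
    (g : Matrix (Fin 3) (Fin 3) ℝ) :
    rowVec (swapLast k * γ) g 0 = rowVec γ g 0 ∧
      rowVec (swapLast k * γ) g 1 = rowVec γ g 2 + (k : ℝ) • rowVec γ g 1 := by
  rw [rowVec_mul, rowVec_mul]
  simp [swapLast, add_comm]

lemma rowVec_sizeReduction (k j l : ℤ) (γ : Matrix.SpecialLinearGroup (Fin 3) ℤ)
    (g : Matrix (Fin 3) (Fin 3) ℝ) :
    rowVec (sizeReduction k j l * γ) g 0 = rowVec γ g 0 ∧
      rowVec (sizeReduction k j l * γ) g 1 = rowVec γ g 1 + (k : ℝ) • rowVec γ g 0 ∧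
      rowVec (sizeReduction k j l * γ) g 2 =
        rowVec γ g 2 + (l : ℝ) • rowVec γ g 1 + (j : ℝ) • rowVec γ g 0 := by
  rw [rowVec_mul, rowVec_mul, rowVec_mul]
  refine ⟨?_, ?_, ?_⟩
  · simp [sizeReduction]
  · simp [sizeReduction, add_comm]
  · simp only [sizeReduction, of_apply, cons_val', cons_val_zero, cons_val_one, cons_val,
      cons_val_fin_one, Int.cast_one, one_smul]
    abel

lemma det_rowVec (γ : Matrix.SpecialLinearGroup (Fin 3) ℤ) (g : G) :
    rowVec γ g 0 ⬝ᵥ (rowVec γ g 1 ⨯₃ rowVec γ g 2) = 1 := by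
  rw [triple_product_eq_det]
  refine Eq.trans (congrArg det ?_) (Matrix.SpecialLinearGroup.map (Int.castRingHom ℝ) γ * g).2
  ext i j
  refine Eq.trans ?_ (coe_map_mul_apply γ g i j).symm
  fin_cases i <;> rfl

lemma row_ne_zero (γ : Matrix.SpecialLinearGroup (Fin 3) ℤ) : (γ : Matrix (Fin 3) (Fin 3) ℤ) 0 ≠ 0 := by
  intro h
  have h1 := γ.2
  rw [det_eq_zero_of_row_eq_zero 0 (fun j => congrFun h j)] at h1
  exact zero_ne_one h1

lemma row_cross_ne_zero (γ : Matrix.SpecialLinearGroup (Fin 3) ℤ) :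
    (γ : Matrix (Fin 3) (Fin 3) ℤ) 0 ⨯₃ (γ : Matrix (Fin 3) (Fin 3) ℤ) 1 ≠ 0 := by
  intro h
  have h1 : (γ : Matrix (Fin 3) (Fin 3) ℤ).det = 1 := γ.2
  have h2 := triple_product_eq_det ((γ : Matrix (Fin 3) (Fin 3) ℤ) 2)
    ((γ : Matrix (Fin 3) (Fin 3) ℤ) 0) ((γ : Matrix (Fin 3) (Fin 3) ℤ) 1)
  rw [h, dotProduct_zero] at h2
  have h3 := h2.trans (det_fin_three _)
  rw [det_fin_three] at h1
  simp only [cons_val_zero, cons_val_one, cons_val] at h3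
  linarith

lemma rowVec_cross (γ : Matrix.SpecialLinearGroup (Fin 3) ℤ) (g : Matrix (Fin 3) (Fin 3) ℝ) :
    rowVec γ g 0 ⨯₃ rowVec γ g 1 = intVec ((γ : Matrix (Fin 3) (Fin 3) ℤ) 0 ⨯₃
      (γ : Matrix (Fin 3) (Fin 3) ℤ) 1) ᵥ* dual g := by
  rw [rowVec, rowVec, vecMul_cross_vecMul, intVec_cross]

lemma sq_systole_le (g : Matrix (Fin 3) (Fin 3) ℝ) (hg : g.det = 1) {m : Fin 3 → ℤ} (hm : m ≠ 0) :
    systole g ^ 2 ≤ normSq (intVec m ᵥ* g) := by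
  have h1 := systole_pos hg
  have h2 := systole_le g hm
  exact (by gcongr : systole g ^ 2 ≤ ‖intVec m ᵥ* g‖ ^ 2).trans (sq_norm_le_normSq _)

/-- There is a basis of the lattice minimising the product of the length of the first vector and of
the area of the parallelogram spanned by the first two. -/
lemma exists_min_flag (g : Matrix (Fin 3) (Fin 3) ℝ) (hg : g.det = 1) :
    ∃ γ : Matrix.SpecialLinearGroup (Fin 3) ℤ, ∀ γ' : Matrix.SpecialLinearGroup (Fin 3) ℤ,
      normSq (rowVec γ g 0) * normSq (rowVec γ g 0 ⨯₃ rowVec γ g 1) ≤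
        normSq (rowVec γ' g 0) * normSq (rowVec γ' g 0 ⨯₃ rowVec γ' g 1) := by
  have h1 := systole_pos hg
  have h2 := systole_pos (det_dual hg)
  set Φ : (Fin 3 → ℤ) × (Fin 3 → ℤ) → ℝ := fun q =>
    normSq (intVec q.1 ᵥ* g) * normSq (intVec q.2 ᵥ* dual g) with hΦ
  set pr : Matrix.SpecialLinearGroup (Fin 3) ℤ → (Fin 3 → ℤ) × (Fin 3 → ℤ) := fun γ =>
    ((γ : Matrix (Fin 3) (Fin 3) ℤ) 0, (γ : Matrix (Fin 3) (Fin 3) ℤ) 0 ⨯₃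
      (γ : Matrix (Fin 3) (Fin 3) ℤ) 1) with hpr
  have hval : ∀ γ, Φ (pr γ) = normSq (rowVec γ g 0) * normSq (rowVec γ g 0 ⨯₃ rowVec γ g 1) := by
    intro γ
    rw [rowVec_cross]
    rfl
  -- Each factor of `Φ` is bounded below by a squared systole, so a bound on the product bounds both
  -- factors.
  have hfin : (Set.range pr ∩ {q | Φ q ≤ Φ (pr 1)}).Finite := by
    refine ((finite_norm_vecMul_le hg (√(Φ (pr 1) / systole (dual g) ^ 2))).prod
      (finite_norm_vecMul_le (det_dual hg) (√(Φ (pr 1) / systole g ^ 2)))).subset ?_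
    rintro _ ⟨⟨γ, rfl⟩, hγ : Φ (pr γ) ≤ _⟩
    have e1 := sq_systole_le g hg (row_ne_zero γ)
    have e2 := sq_systole_le (dual g) (det_dual hg) (row_cross_ne_zero γ)
    refine ⟨Real.le_sqrt_of_sq_le ((sq_norm_le_normSq _).trans ?_),
      Real.le_sqrt_of_sq_le ((sq_norm_le_normSq _).trans ?_)⟩
    · rw [le_div_iff₀ (by positivity)]
      exact (mul_le_mul_of_nonneg_left e2 (normSq_nonneg _)).trans hγ
    · rw [le_div_iff₀ (by positivity), mul_comm]
      exact (mul_le_mul_of_nonneg_right e1 (normSq_nonneg _)).trans hγ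
  obtain ⟨_, ⟨⟨γ, rfl⟩, hγ⟩, hmin⟩ := Set.exists_min_image _ Φ hfin
    ⟨pr 1, ⟨1, rfl⟩, (le_rfl : Φ (pr 1) ≤ _)⟩
  refine ⟨γ, fun γ' => ?_⟩
  rw [← hval, ← hval]
  by_cases h : Φ (pr γ') ≤ Φ (pr 1)
  · exact hmin _ ⟨⟨γ', rfl⟩, h⟩
  · exact le_trans hγ (not_le.1 h).le

/-- The reduction inequalities for a basis minimising the flag. -/
lemma flag_inequalities {g : G} {γ : Matrix.SpecialLinearGroup (Fin 3) ℤ}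
    (hγ : ∀ γ' : Matrix.SpecialLinearGroup (Fin 3) ℤ,
      normSq (rowVec γ g 0) * normSq (rowVec γ g 0 ⨯₃ rowVec γ g 1) ≤
        normSq (rowVec γ' g 0) * normSq (rowVec γ' g 0 ⨯₃ rowVec γ' g 1))
    (ha : 0 < normSq (rowVec γ g 0)) (hd : 0 < normSq (rowVec γ g 0 ⨯₃ rowVec γ g 1)) :
    3 / 4 * normSq (rowVec γ g 0) ^ 2 ≤ normSq (rowVec γ g 0 ⨯₃ rowVec γ g 1) ∧
    3 / 4 * normSq (rowVec γ g 0 ⨯₃ rowVec γ g 1) ^ 2 ≤ normSq (rowVec γ g 0) ∧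
    normSq ((rowVec γ g 0 ⨯₃ rowVec γ g 1) ⨯₃ (rowVec γ g 0 ⨯₃ rowVec γ g 2)) =
      normSq (rowVec γ g 0) := by
  have hdet := det_rowVec γ g
  -- This swap preserves the area, so minimality compares the first vectors; the swap below
  -- preserves the first vector and compares areas.
  have hswap : ∀ k : ℤ, normSq (rowVec γ g 0) ≤ normSq (rowVec γ g 1 + (k : ℝ) • rowVec γ g 0) := by
    intro k
    have h := hγ (swapFst k * γ)
    rw [(rowVec_swapFst k γ _).1, (rowVec_swapFst k γ _).2] at h
    have h2 : (rowVec γ g 1 + (k : ℝ) • rowVec γ g 0) ⨯₃ (-rowVec γ g 0) =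
        rowVec γ g 0 ⨯₃ rowVec γ g 1 := by
      rw [map_neg, map_add, LinearMap.add_apply, map_smul, LinearMap.smul_apply, cross_self,
        smul_zero, add_zero, cross_anticomm]
    rw [h2] at h
    exact le_of_mul_le_mul_right h hd
  have hswap2 : ∀ k : ℤ, normSq (rowVec γ g 0 ⨯₃ rowVec γ g 1) ≤
      normSq (rowVec γ g 0 ⨯₃ rowVec γ g 2 + (k : ℝ) • (rowVec γ g 0 ⨯₃ rowVec γ g 1)) := by
    intro k
    have h := hγ (swapLast k * γ)
    rw [(rowVec_swapLast k γ _).1, (rowVec_swapLast k γ _).2, map_add, map_smul] at h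
    exact le_of_mul_le_mul_left h ha
  have hN : normSq ((rowVec γ g 0 ⨯₃ rowVec γ g 1) ⨯₃ (rowVec γ g 0 ⨯₃ rowVec γ g 2)) =
      normSq (rowVec γ g 0) := by
    have : (rowVec γ g 0 ⨯₃ rowVec γ g 1) ⨯₃ (rowVec γ g 0 ⨯₃ rowVec γ g 2) =
        (rowVec γ g 0 ⬝ᵥ (rowVec γ g 1 ⨯₃ rowVec γ g 2)) • rowVec γ g 0 := by
      simp only [cross_apply, dotProduct, Fin.sum_univ_three, cons_val_zero, cons_val_one, cons_val]
      ext i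
      fin_cases i <;> simp <;> ring
    rw [this, hdet, one_smul]
  refine ⟨?_, ?_, hN⟩
  · obtain ⟨k, hk⟩ := exists_int_reduce _ (rowVec γ g 1) ha
    nlinarith [mul_le_mul_of_nonneg_left (hswap k) ha.le]
  · obtain ⟨k, hk⟩ := exists_int_reduce _ (rowVec γ g 0 ⨯₃ rowVec γ g 2) hd
    rw [hN] at hk
    nlinarith [mul_le_mul_of_nonneg_left (hswap2 k) hd.le]

/-- Mahler's criterion: the lattices without short dual vectors lie over a bounded set. -/
theorem exists_bounded_representative {c : ℝ} (hc : 0 < c) : ∃ R : ℝ, ∀ g : G,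
    c ≤ systole (dual (g : Matrix (Fin 3) (Fin 3) ℝ)) → ∃ γ ∈ Γ, ∀ i j, |(γ * g) i j| ≤ R := by
  set a₀ : ℝ := 3 / 4 * (c ^ 2) ^ 2 with ha₀
  have ha₀0 : 0 < a₀ := by positivity
  refine ⟨4 + 6 / a₀ + (6 / c ^ 2 + 3) / a₀, fun g hg => ?_⟩
  obtain ⟨γ, hγ⟩ := exists_min_flag (g : Matrix (Fin 3) (Fin 3) ℝ) g.2
  have hd : c ^ 2 ≤ normSq (rowVec γ g 0 ⨯₃ rowVec γ g 1) := by
    rw [rowVec_cross]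
    exact (by gcongr : c ^ 2 ≤ systole (dual (g : Matrix (Fin 3) (Fin 3) ℝ)) ^ 2).trans
      (sq_systole_le _ (det_dual g.2) (row_cross_ne_zero γ))
  have hd0 : 0 < normSq (rowVec γ g 0 ⨯₃ rowVec γ g 1) := (by positivity : 0 < c ^ 2).trans_le hd
  have ha0 : 0 < normSq (rowVec γ g 0) :=
    (pow_pos (systole_pos g.2) 2).trans_le (sq_systole_le _ g.2 (row_ne_zero γ))
  obtain ⟨h1, h2, h3⟩ := flag_inequalities hγ ha0 hd0
  set a := normSq (rowVec γ g 0) with ha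
  set d := normSq (rowVec γ g 0 ⨯₃ rowVec γ g 1) with hdd
  -- Adding the two reduction inequalities gives 3(a² + d²)/4 ≤ a + d, hence a + d ≤ 8/3. The lower
  -- bound on `d` then yields one on `a`, which is why the dual systole alone suffices.
  have had : a + d ≤ 3 := by nlinarith [sq_nonneg (a - d)]
  have haa : a₀ ≤ a := by
    have : (c ^ 2) ^ 2 ≤ d ^ 2 := by gcongr
    linarith
  obtain ⟨k, hk⟩ := exists_int_reduce _ (rowVec γ g 1) ha0
  obtain ⟨l, hl⟩ := exists_int_reduce _ (rowVec γ g 0 ⨯₃ rowVec γ g 2) hd0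
  rw [h3] at hl
  have hcr : rowVec γ g 0 ⨯₃ rowVec γ g 2 + (l : ℝ) • (rowVec γ g 0 ⨯₃ rowVec γ g 1) =
      rowVec γ g 0 ⨯₃ (rowVec γ g 2 + (l : ℝ) • rowVec γ g 1) := by
    rw [map_add, map_smul]
  rw [hcr] at hl
  obtain ⟨j, hj⟩ := exists_int_reduce _ (rowVec γ g 2 + (l : ℝ) • rowVec γ g 1) ha0
  obtain ⟨hr0, hr1, hr2⟩ := rowVec_sizeReduction k j l γ (g : Matrix (Fin 3) (Fin 3) ℝ)
  set γ' := sizeReduction k j l * γ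
  have hbd : ∀ x M : ℝ, a * x ≤ M → 0 ≤ x → 0 ≤ M → x ≤ M / a₀ := by
    intro x M h hx hM
    rw [le_div_iff₀ ha₀0]
    nlinarith
  have hsq : a ^ 2 ≤ 9 := by nlinarith
  have hsqd : d ^ 2 ≤ 9 := by nlinarith
  have hN1 : normSq (rowVec γ' g 1) ≤ 6 / a₀ := by
    rw [hr1]
    exact hbd _ _ (by linarith) (normSq_nonneg _) (by norm_num)
  have hN2 : normSq (rowVec γ' g 2) ≤ (6 / c ^ 2 + 3) / a₀ := by
    rw [hr2]
    have : normSq (rowVec γ g 0 ⨯₃ (rowVec γ g 2 + (l : ℝ) • rowVec γ g 1)) ≤ 6 / c ^ 2 := by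
      rw [le_div_iff₀ (by positivity)]
      have := mul_le_mul_of_nonneg_right hd
        (normSq_nonneg (rowVec γ g 0 ⨯₃ (rowVec γ g 2 + (l : ℝ) • rowVec γ g 1)))
      linarith
    exact hbd _ _ (by linarith) (normSq_nonneg _) (by positivity)
  refine ⟨_, ⟨γ', rfl⟩, fun i j => ?_⟩
  rw [coe_map_mul_apply]
  have hle := sq_apply_le_normSq (rowVec γ' g i) j
  have habs : |rowVec γ' g i j| ≤ 1 + normSq (rowVec γ' g i) := by
    rw [abs_le]
    constructor <;> nlinarith [sq_nonneg (rowVec γ' g i j - 1), sq_nonneg (rowVec γ' g i j + 1)]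
  have hp1 : 0 ≤ 6 / a₀ := by positivity
  have hp2 : 0 ≤ (6 / c ^ 2 + 3) / a₀ := by positivity
  have hN : normSq (rowVec γ' g i) ≤ 3 + 6 / a₀ + (6 / c ^ 2 + 3) / a₀ := by
    fin_cases i
    · simp only [Fin.zero_eta]
      rw [hr0]
      linarith
    · simp only [Fin.mk_one]
      linarith
    · simp only [Fin.reduceFinMk]
      linarith
  linarith

end Reduction

/-! ### The height function and its contraction. -/

section Height

open Matrix

variable {t L : ℕ}

lemma exp_bounds (t : ℕ) : Real.exp (t / 2) ≤ Real.exp t ∧ Real.exp (-(t / 2 : ℝ)) ≤ Real.exp t ∧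
    Real.exp (-t) ≤ Real.exp t ∧ (1 : ℝ) ≤ Real.exp t := by
  have ht : (0 : ℝ) ≤ t := t.cast_nonneg
  refine ⟨?_, ?_, ?_, ?_⟩
  · exact Real.exp_le_exp.2 (by linarith)
  · exact Real.exp_le_exp.2 (by linarith)
  · exact Real.exp_le_exp.2 (by linarith)
  · exact Real.one_le_exp ht

lemma abs_mul_exp_le {x y e E : ℝ} (he : 0 ≤ e) (heE : e ≤ E) (hx : |x| ≤ y) : |e * x| ≤ E * y := by
  rw [abs_mul, abs_of_nonneg he]
  exact mul_le_mul heE hx (abs_nonneg _) (he.trans heE)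

lemma norm_vecMul_stepMat_le (d : Digit L) (v : Fin 3 → ℝ) :
    ‖v ᵥ* stepMat t d‖ ≤ 3 * Real.exp t * ‖v‖ ∧ ‖v‖ ≤ 3 * Real.exp t * ‖v ᵥ* stepMat t d‖ := by
  obtain ⟨e1, e2, e3, e4⟩ := exp_bounds t
  have hd1 := abs_gridPt_fst_le d
  have hd2 := abs_gridPt_snd_le d
  have hdv : ∀ (u : Fin 3 → ℝ) i (b : ℝ), |b| ≤ 1 → |u i * b| ≤ ‖u‖ := fun u i b hb => by
    rw [abs_mul]
    exact (mul_le_of_le_one_right (abs_nonneg _) hb).trans (norm_le_pi_norm u i)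
  have hv : ∀ i, |v i| ≤ ‖v‖ := norm_le_pi_norm v
  have hv0 := norm_nonneg v
  have hE := Real.exp_pos (t : ℝ)
  constructor
  · rw [vecMul_stepMat]
    refine norm_vec_le ?_ ?_ ?_
    · have := abs_mul_exp_le (Real.exp_pos _).le e1 ((abs_add_le _ _).trans
        (add_le_add (hv 0) (hdv v 2 _ hd1)))
      nlinarith
    · have := abs_mul_exp_le (Real.exp_pos _).le e1 ((abs_add_le _ _).trans
        (add_le_add (hv 1) (hdv v 2 _ hd2)))
      nlinarith
    · have := abs_mul_exp_le (Real.exp_pos _).le e3 (hv 2)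
      nlinarith
  · set w := v ᵥ* stepMat t d with hw
    have hw' := hw
    rw [vecMul_stepMat] at hw'
    have hwn : ∀ i, |w i| ≤ ‖w‖ := norm_le_pi_norm w
    have h0 : v 0 = Real.exp (-(t / 2)) * w 0 - v 2 * (gridPt d).1 := by
      rw [hw', Real.exp_neg]
      simp
    have h1 : v 1 = Real.exp (-(t / 2)) * w 1 - v 2 * (gridPt d).2 := by
      rw [hw', Real.exp_neg]
      simp
    have h2 : v 2 = Real.exp t * w 2 := by
      rw [hw', Real.exp_neg]
      simp
    have b2 : |v 2| ≤ Real.exp t * ‖w‖ := by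
      rw [h2]
      exact abs_mul_exp_le hE.le le_rfl (hwn 2)
    have hmul : ∀ b : ℝ, |b| ≤ 1 → |v 2 * b| ≤ Real.exp t * ‖w‖ := fun b hb => by
      rw [abs_mul]
      exact (mul_le_of_le_one_right (abs_nonneg _) hb).trans b2
    have hw0 := norm_nonneg w
    have hp : 0 ≤ Real.exp t * ‖w‖ := by positivity
    refine (pi_norm_le_iff_of_nonneg (by positivity)).2 fun i => ?_
    rw [Real.norm_eq_abs]
    fin_cases i
    · simp only [Fin.zero_eta]
      rw [h0]
      have := abs_sub (Real.exp (-(t / 2)) * w 0) (v 2 * (gridPt d).1)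
      linarith [abs_mul_exp_le (Real.exp_pos _).le e2 (hwn 0), hmul _ hd1]
    · simp only [Fin.mk_one]
      rw [h1]
      have := abs_sub (Real.exp (-(t / 2)) * w 1) (v 2 * (gridPt d).2)
      linarith [abs_mul_exp_le (Real.exp_pos _).le e2 (hwn 1), hmul _ hd2]
    · simp only [Fin.reduceFinMk]
      linarith

lemma norm_vecMul_dual_stepMat_le (d : Digit L) (v : Fin 3 → ℝ) :
    ‖v ᵥ* dual (stepMat t d)‖ ≤ 3 * Real.exp t * ‖v‖ ∧
      ‖v‖ ≤ 3 * Real.exp t * ‖v ᵥ* dual (stepMat t d)‖ := by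
  obtain ⟨e1, e2, e3, e4⟩ := exp_bounds t
  have hd1 := abs_gridPt_fst_le d
  have hd2 := abs_gridPt_snd_le d
  have hdv : ∀ (x y b : ℝ), |x| ≤ y → |b| ≤ 1 → |x * b| ≤ y := fun x y b hx hb => by
    rw [abs_mul]
    exact (mul_le_of_le_one_right (abs_nonneg _) hb).trans hx
  have hv : ∀ i, |v i| ≤ ‖v‖ := norm_le_pi_norm v
  have hv0 := norm_nonneg v
  have hE := Real.exp_pos (t : ℝ)
  constructor
  · rw [vecMul_dual_stepMat]
    refine norm_vec_le ?_ ?_ ?_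
    · have := abs_mul_exp_le (Real.exp_pos _).le e2 (hv 0)
      nlinarith
    · have := abs_mul_exp_le (Real.exp_pos _).le e2 (hv 1)
      nlinarith
    · have h3 : |v 2 - v 0 * (gridPt d).1 - v 1 * (gridPt d).2| ≤ 3 * ‖v‖ := by
        have h1 := abs_sub (v 2 - v 0 * (gridPt d).1) (v 1 * (gridPt d).2)
        have h2 := abs_sub (v 2) (v 0 * (gridPt d).1)
        linarith [hv 2, hdv _ _ _ (hv 0) hd1, hdv _ _ _ (hv 1) hd2]
      have := abs_mul_exp_le (Real.exp_pos _).le (le_refl (Real.exp t)) h3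
      linarith
  · set w := v ᵥ* dual (stepMat t d) with hw
    have hw' := hw
    rw [vecMul_dual_stepMat] at hw'
    have hwn : ∀ i, |w i| ≤ ‖w‖ := norm_le_pi_norm w
    have h0 : v 0 = Real.exp (t / 2) * w 0 := by
      rw [hw', Real.exp_neg]
      simp
    have h1 : v 1 = Real.exp (t / 2) * w 1 := by
      rw [hw', Real.exp_neg]
      simp
    have h2 : v 2 = Real.exp (-t) * w 2 + v 0 * (gridPt d).1 + v 1 * (gridPt d).2 := by
      rw [hw', Real.exp_neg]
      simp
      ring
    have b0 : |v 0| ≤ Real.exp t * ‖w‖ := by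
      rw [h0]
      exact abs_mul_exp_le (Real.exp_pos _).le e1 (hwn 0)
    have b1 : |v 1| ≤ Real.exp t * ‖w‖ := by
      rw [h1]
      exact abs_mul_exp_le (Real.exp_pos _).le e1 (hwn 1)
    have hw0 := norm_nonneg w
    have hp : 0 ≤ Real.exp t * ‖w‖ := by positivity
    refine (pi_norm_le_iff_of_nonneg (by positivity)).2 fun i => ?_
    rw [Real.norm_eq_abs]
    fin_cases i
    · simp only [Fin.zero_eta]
      linarith
    · simp only [Fin.mk_one]
      linarith
    · simp only [Fin.reduceFinMk]
      have c1 := abs_add_le (Real.exp (-t) * w 2 + v 0 * (gridPt d).1) (v 1 * (gridPt d).2)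
      have c2 := abs_add_le (Real.exp (-t) * w 2) (v 0 * (gridPt d).1)
      rw [← h2] at c1
      linarith [abs_mul_exp_le (Real.exp_pos _).le e3 (hwn 2), hdv _ _ _ b0 hd1, hdv _ _ _ b1 hd2]

/-- In the first case of the dichotomy the average over a single vector applies. In the second,
systole^{-2} is bounded by a multiple of (dual systole)^{-1}, and a step changes lengths by a
bounded factor. -/
lemma sum_inv_sq_systole_le (hL : Real.exp (3 * t / 2) ≤ L) {h : Matrix (Fin 3) (Fin 3) ℝ}
    (hh : h.det = 1) : ∑ d : Digit L, (systole (h * stepMat t d) ^ 2)⁻¹ ≤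
      Fintype.card (Digit L) * (rate t L * (systole h ^ 2)⁻¹ +
        2 * (3 * Real.exp t) ^ 4 * (systole (dual h))⁻¹) := by
  set A : ℝ := 3 * Real.exp t with hA
  have hA0 : 0 < A := by positivity
  have hs := systole_pos hh
  have hs' := systole_pos (det_dual hh)
  have hκ := rate_pos t L
  have hd : ∀ d : Digit L, (h * stepMat t d).det = 1 := fun d => by
    rw [det_mul, hh, det_stepMat, one_mul]
  rcases systole_dichotomy hh (E := Set.range (stepMat t (L := L))) hA0.le
    (by rintro _ ⟨d, rfl⟩; exact ⟨det_stepMat d, norm_vecMul_stepMat_le d⟩) with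
    ⟨w, hw, hwle⟩ | hdual
  · have hw0 : w ≠ 0 := norm_pos_iff.1 (hw ▸ hs)
    calc ∑ d : Digit L, (systole (h * stepMat t d) ^ 2)⁻¹
        ≤ ∑ d : Digit L, (‖w ᵥ* stepMat t d‖ ^ 2)⁻¹ := by
          refine Finset.sum_le_sum fun d _ => ?_
          have h1 := (norm_vecMul_stepMat_le (t := t) d w).2
          have h2 : 0 < ‖w ᵥ* stepMat t d‖ := by
            rw [hw] at h1
            exact pos_of_mul_pos_right (hs.trans_le h1) hA0.le
          have := hwle _ ⟨d, rfl⟩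
          gcongr
      _ ≤ _ := sum_inv_sq_norm_le hL hw0
      _ ≤ _ := by
          rw [hw]
          gcongr
          have : 0 ≤ 2 * A ^ 4 * (systole (dual h))⁻¹ := by positivity
          linarith
  · calc ∑ d : Digit L, (systole (h * stepMat t d) ^ 2)⁻¹
        ≤ ∑ _d : Digit L, 2 * A ^ 4 * (systole (dual h))⁻¹ := by
          refine Finset.sum_le_sum fun d _ => ?_
          have h1 := systole_le_mul_systole_mul hh (det_stepMat (t := t) d)
            fun v => (norm_vecMul_stepMat_le d v).2
          have h2 := systole_pos (hd d)
          rw [inv_le_comm₀ (by positivity) (by positivity), mul_inv, inv_inv,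
            inv_mul_le_iff₀ (by positivity)]
          calc systole (dual h) ≤ 2 * A ^ 2 * systole h ^ 2 := hdual
            _ ≤ 2 * A ^ 2 * (A * systole (h * stepMat t d)) ^ 2 := by gcongr
            _ = _ := by ring
      _ ≤ _ := by
          rw [Finset.sum_const, Finset.card_univ, nsmul_eq_mul]
          gcongr
          have : 0 ≤ rate t L * (systole h ^ 2)⁻¹ := by positivity
          linarith

/-- In the second case of the dichotomy (dual systole)^{-1} is of order at most systole^{-1/2},
lower than systole^{-2}. By Young's inequality the cross term can thus have any coefficient `τ > 0`,
at the price of a constant. -/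
lemma sum_inv_systole_dual_le (hL : Real.exp (3 * t / 2) ≤ L) {τ : ℝ} (hτ : 0 < τ) :
    ∃ C, 0 ≤ C ∧ ∀ h : Matrix (Fin 3) (Fin 3) ℝ, h.det = 1 →
      ∑ d : Digit L, (systole (dual (h * stepMat t d)))⁻¹ ≤
        Fintype.card (Digit L) * (rate t L * (systole (dual h))⁻¹ + τ * (systole h ^ 2)⁻¹ + C) := by
  set A : ℝ := 3 * Real.exp t with hA
  have hA0 : 0 < A := by positivity
  refine ⟨A * (1 + A ^ 5 / τ), by positivity, fun h hh => ?_⟩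
  have hs := systole_pos hh
  have hs' := systole_pos (det_dual hh)
  have hκ := rate_pos t L
  rcases systole_dichotomy (det_dual hh) (E := Set.range fun d : Digit L => dual (stepMat t d))
    hA0.le (by rintro _ ⟨d, rfl⟩; exact ⟨det_dual (det_stepMat d), norm_vecMul_dual_stepMat_le d⟩)
    with ⟨w, hw, hwle⟩ | hdual
  · have hw0 : w ≠ 0 := norm_pos_iff.1 (hw ▸ hs')
    calc ∑ d : Digit L, (systole (dual (h * stepMat t d)))⁻¹
        ≤ ∑ d : Digit L, ‖w ᵥ* dual (stepMat t d)‖⁻¹ := by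
          refine Finset.sum_le_sum fun d _ => ?_
          have h1 := (norm_vecMul_dual_stepMat_le (t := t) d w).2
          have h2 : 0 < ‖w ᵥ* dual (stepMat t d)‖ := by
            rw [hw] at h1
            exact pos_of_mul_pos_right (hs'.trans_le h1) hA0.le
          have := hwle _ ⟨d, rfl⟩
          rw [dual_mul]
          gcongr
      _ ≤ _ := sum_inv_norm_dual_le hL hw0
      _ ≤ _ := by
          rw [hw]
          gcongr
          have : 0 ≤ τ * (systole h ^ 2)⁻¹ + A * (1 + A ^ 5 / τ) := by positivity
          linarith
  · rw [dual_dual hh] at hdual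
    have hb : (systole (dual h))⁻¹ ≤ 1 + (systole (dual h))⁻¹ ^ 2 := by
      nlinarith [sq_nonneg ((systole (dual h))⁻¹ - 1)]
    have hb2 : (systole (dual h))⁻¹ ^ 2 ≤ 2 * A ^ 2 * (systole h)⁻¹ := by
      rw [inv_pow, inv_le_comm₀ (by positivity) (by positivity), mul_inv, inv_inv,
        inv_mul_le_iff₀ (by positivity)]
      exact hdual
    have hyoung : A * (2 * A ^ 2 * (systole h)⁻¹) ≤
        τ * (systole h ^ 2)⁻¹ + A * (A ^ 5 / τ) := by
      have h1 : 0 ≤ (τ * (systole h)⁻¹ - A ^ 3) ^ 2 / τ := by positivity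
      have h2 : (τ * (systole h)⁻¹ - A ^ 3) ^ 2 / τ =
          τ * (systole h ^ 2)⁻¹ + A * (A ^ 5 / τ) - A * (2 * A ^ 2 * (systole h)⁻¹) := by
        field_simp
        ring
      linarith
    calc ∑ d : Digit L, (systole (dual (h * stepMat t d)))⁻¹
        ≤ ∑ _d : Digit L, A * (systole (dual h))⁻¹ := by
          refine Finset.sum_le_sum fun d _ => ?_
          have h1 := systole_le_mul_systole_mul (det_dual hh) (det_dual (det_stepMat (t := t) d))
            fun v => (norm_vecMul_dual_stepMat_le d v).2
          rw [dual_mul]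
          have h2 : 0 < systole (dual h * dual (stepMat t d)) :=
            pos_of_mul_pos_right (hs'.trans_le h1) hA0.le
          rw [inv_le_comm₀ h2 (by positivity), mul_inv, inv_inv, inv_mul_le_iff₀ hA0]
          exact h1
      _ ≤ _ := by
          rw [Finset.sum_const, Finset.card_univ, nsmul_eq_mul]
          gcongr
          have h1 := mul_le_mul_of_nonneg_left (hb.trans (add_le_add_right hb2 1)) hA0.le
          have h3 : 0 ≤ rate t L * (systole (dual h))⁻¹ := by positivity
          linarith

/-- A height function on `G` which is contracted on average by the walk, up to a constant. -/
lemma exists_height (hL : Real.exp (3 * t / 2) ≤ L) : ∃ (F : G → ℝ) (b : ℝ), 0 ≤ b ∧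
    (∀ x, 0 ≤ F x) ∧
    (∀ x, ∑ d : Digit L, F (step t x d) ≤ Fintype.card (Digit L) * (2 * rate t L * F x + b)) ∧
    ∃ Λ > 0, ∀ x : G, Λ * (systole (dual (x : Matrix (Fin 3) (Fin 3) ℝ)))⁻¹ ≤ F x := by
  have hκ := rate_pos t L
  set C₁ : ℝ := 2 * (3 * Real.exp t) ^ 4 with hC₁
  have hC₁0 : 0 < C₁ := by positivity
  -- With this `Λ` and `τ = rate t L / Λ`, each cross term equals `rate t L` times the other summand
  -- of the height, whence the factor `2 * rate t L`.
  set Λ : ℝ := C₁ / rate t L with hΛ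
  have hΛ0 : 0 < Λ := by positivity
  obtain ⟨C, hC0, hC⟩ := sum_inv_systole_dual_le hL (τ := rate t L / Λ) (by positivity)
  have hpos : ∀ x : G, 0 < systole (x : Matrix (Fin 3) (Fin 3) ℝ) := fun x => systole_pos x.2
  have hpos' : ∀ x : G, 0 < systole (dual (x : Matrix (Fin 3) (Fin 3) ℝ)) := fun x =>
    systole_pos (det_dual x.2)
  refine ⟨fun x => (systole (x : Matrix (Fin 3) (Fin 3) ℝ) ^ 2)⁻¹ +
    Λ * (systole (dual (x : Matrix (Fin 3) (Fin 3) ℝ)))⁻¹, Λ * C, by positivity, fun x => ?_,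
    fun x => ?_, Λ, hΛ0, fun x => ?_⟩
  · have := hpos x
    have := hpos' x
    positivity
  · have h1 := sum_inv_sq_systole_le hL x.2
    have h2 := mul_le_mul_of_nonneg_left (hC _ x.2) hΛ0.le
    simp only [coe_step, Finset.sum_add_distrib, ← Finset.mul_sum]
    refine (add_le_add h1 h2).trans (le_of_eq ?_)
    rw [hΛ]
    field_simp
    ring
  · have := hpos x
    simp
    positivity

/-- With L = ⌈e^{3t/2}⌉ there are e^{3t} digits up to a bounded factor, and `rate t L` is e^{-t}
times a quadratic in `t`. For large `t` the excess is absorbed by e^{εt}. -/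
lemma exists_time {ε : ℝ} (hε : 0 < ε) (hε1 : ε ≤ 1) : ∃ t L : ℕ, 0 < t ∧
    Real.exp (3 * t / 2) ≤ L ∧
    Real.log (Fintype.card (Digit L)) + Real.log 2 ≤ (3 + ε) * t ∧
    3 * rate t L ≤ 2 * Real.exp (-((1 - ε) * t)) ∧ 2 * rate t L ≤ 1 := by
  -- 147 = 3 · 7², since `logBound` is at most 7t once t ≥ 20.
  have h1 : ∀ᶠ t : ℕ in atTop, (t : ℝ) ^ 2 ≤ 1 / 147 * Real.exp (ε * t) := by
    have := ((isLittleO_pow_exp_pos_mul_atTop 2 hε).bound (by norm_num : (0 : ℝ) < 1 / 147))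
    filter_upwards [tendsto_natCast_atTop_atTop.eventually this] with t ht
    rwa [Real.norm_of_nonneg (by positivity), Real.norm_of_nonneg (Real.exp_pos _).le] at ht
  have h2 : ∀ᶠ t : ℕ in atTop, 9 / ε ≤ t := tendsto_natCast_atTop_atTop.eventually_ge_atTop _
  obtain ⟨t, ht1, ht2, ht3⟩ := (h1.and (h2.and (eventually_ge_atTop 20))).exists
  have ht3' : (20 : ℝ) ≤ t := by exact_mod_cast ht3
  rw [div_le_iff₀ hε] at ht2
  have hexp1 : (1 : ℝ) ≤ Real.exp (3 * t / 2) := Real.one_le_exp (by positivity)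
  have hlogL : Real.log (2 * (⌈Real.exp (3 * t / 2)⌉₊ : ℝ) + 1) ≤ 4 + 3 * t / 2 := by
    have hceil := (Nat.ceil_lt_add_one (Real.exp_pos (3 * t / 2)).le).le
    have h5 : Real.log 5 ≤ 4 := by
      have := Real.log_le_sub_one_of_pos (show (0 : ℝ) < 5 by norm_num)
      linarith
    calc Real.log (2 * (⌈Real.exp (3 * t / 2)⌉₊ : ℝ) + 1)
        ≤ Real.log (5 * Real.exp (3 * t / 2)) := Real.log_le_log (by positivity) (by linarith)
      _ = Real.log 5 + 3 * t / 2 := by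
          rw [Real.log_mul (by norm_num) (Real.exp_ne_zero _), Real.log_exp]
      _ ≤ _ := by linarith
  have hrate : 3 * rate t ⌈Real.exp (3 * t / 2)⌉₊ ≤ Real.exp (-((1 - ε) * t)) := by
    have hS : logBound ⌈Real.exp (3 * t / 2)⌉₊ ≤ 7 * t := by
      unfold logBound
      linarith
    have hS0 := four_le_logBound ⌈Real.exp (3 * t / 2)⌉₊
    calc 3 * rate t ⌈Real.exp (3 * t / 2)⌉₊ ≤ 3 * ((7 * t) ^ 2 * Real.exp (-t)) := by
          unfold rate
          gcongr
      _ = 147 * (t ^ 2 * Real.exp (-t)) := by ring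
      _ ≤ 147 * (1 / 147 * Real.exp (ε * t) * Real.exp (-t)) := by gcongr
      _ = Real.exp (ε * t) * Real.exp (-t) := by ring
      _ = _ := by
          rw [← Real.exp_add]
          ring_nf
  have hle1 : Real.exp (-((1 - ε) * t)) ≤ 1 := by
    rw [Real.exp_le_one_iff]
    have : 0 ≤ (1 - ε) * t := mul_nonneg (by linarith) (by linarith)
    linarith
  have hexp0 := Real.exp_pos (-((1 - ε) * t))
  have hr0 := rate_pos t ⌈Real.exp (3 * t / 2)⌉₊
  refine ⟨t, ⌈Real.exp (3 * t / 2)⌉₊, by omega, Nat.le_ceil _, ?_, by linarith, by linarith⟩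
  rw [cast_card_digit, Real.log_pow]
  have hlog2 : Real.log 2 ≤ 1 := by
    have := Real.log_le_sub_one_of_pos (show (0 : ℝ) < 2 by norm_num)
    linarith
  push_cast
  linarith

end Height

/-! ### The uniform entropy bound and its passage to weak* limits. -/

/-- Up to a small error, the entropy is at most `2 + μ(K)` for a compact set `K` which does not
depend on the measure. -/
theorem exists_compact_entropy_le {ε : ℝ} (hε : 0 < ε) (hε1 : ε ≤ 1) :
    ∃ K : Set X, IsCompact K ∧ ∀ μ : Measure X, IsProbabilityMeasure μ → MeasurePreserving T μ μ →
      entropy T μ ≤ ((2 + 3 * ε + μ.real K : ℝ) : EReal) := by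
  classical
  obtain ⟨t, L, ht, hL, hR, hrate, hrate1⟩ := exists_time hε hε1
  obtain ⟨F, b, hb, hF0, hF, Λ, hΛ, hΛF⟩ := exists_height hL
  have hκ := rate_pos t L
  set B : ℝ := max b 1 with hB
  have hB1 : 1 ≤ B := le_max_right _ _
  have hBb : b ≤ B := le_max_left _ _
  -- Where `F` is at least `M`, the additive constants are at most `rate t L * F`, so `F + B`
  -- averages to at most `3 * rate t L` times itself. Below `M`, the bounds `2 * rate t L ≤ 1` and
  -- `b ≤ B` give at most doubling.
  set M : ℝ := (b + B) / rate t L with hM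
  have hM0 : 0 < M := by positivity
  obtain ⟨R, hRep⟩ := exists_bounded_representative (c := Λ / M) (by positivity)
  set S : Set G := {x | F x < M} with hS
  set β : ℝ := (1 - ε) * t with hβ
  have ht' : (0 : ℝ) < t := by exact_mod_cast ht
  refine ⟨proj '' {h : G | ∃ x ∈ {g : G | ∀ i j, |g i j| ≤ R}, ∃ v : ℝ × ℝ, ‖v‖ ≤ 1 ∧
    ∃ p ∈ parab 1, x * unip v * p = h}, (isCompact_mul_unip_parab (isCompact_entries_le R)).image
    isOpenQuotientMap_proj.continuous, fun μ hμ hT => ?_⟩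
  refine entropy_le_of_walk (φ := fun x => F x + B) (S := S) (β := β) hL
    (fun x => by linarith [hF0 x]) (mul_nonneg (by linarith) ht'.le) hε hε1 (fun x => ?_)
    ((isCompact_mul_unip_parab (isCompact_entries_le R)).image isOpenQuotientMap_proj.continuous)
    ?_ ht hR le_rfl (mul_le_of_le_one_left ht'.le (by linarith)) hT
  · rw [Finset.sum_add_distrib, Finset.sum_const, Finset.card_univ, nsmul_eq_mul]
    refine (add_le_add (hF x) le_rfl).trans ?_
    rw [← mul_add]
    gcongr
    have hFx := hF0 x
    split_ifs with hx
    · nlinarith [mul_le_mul_of_nonneg_right hrate1 hFx]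
    · have hx' : M ≤ F x := not_lt.1 hx
      rw [hM, div_le_iff₀ hκ] at hx'
      have h1 := mul_le_mul_of_nonneg_right hrate (add_nonneg hFx (by linarith : 0 ≤ B))
      have h2 : 0 ≤ 3 * rate t L * B := by positivity
      linarith
  · intro x hx v hv p hp
    have hpos := systole_pos (det_dual x.2)
    obtain ⟨γ, hγ, hγx⟩ := hRep x (by
      have h1 : Λ * (systole (dual (x : Matrix (Fin 3) (Fin 3) ℝ)))⁻¹ ≤ M :=
        (hΛF x).trans (le_of_lt hx)
      rw [← div_eq_mul_inv, div_le_iff₀ hpos] at h1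
      rw [div_le_iff₀ hM0]
      linarith)
    refine ⟨γ * x * unip v * p, ⟨γ * x, hγx, v, hv, p, hp, rfl⟩, ?_⟩
    exact (proj_eq_proj_iff.2 ⟨γ, hγ, by group⟩).symm

/-- Entropy controls the escape of mass: a lower bound `c` on the entropies of a sequence of invariant
probability measures gives the lower bound `c - 2` on the mass of its weak* limits. -/
theorem sub_two_le_measure_univ_of_isWeakStarLimit {c : ℝ} {μ : ℕ → Measure X}
    (hprob : ∀ i, IsProbabilityMeasure (μ i)) (hinv : ∀ i, MeasurePreserving T (μ i) (μ i))
    (hent : ∀ i, (c : EReal) ≤ entropy T (μ i)) {ν : Measure X} (hν : IsWeakStarLimit μ ν) :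
    ENNReal.ofReal (c - 2) ≤ ν Set.univ := by
  obtain ⟨hfin, φ, -, hlim⟩ := hν
  rcases eq_or_ne (ν Set.univ) ⊤ with htop | htop
  · rw [htop]
    exact le_top
  have : IsFiniteMeasure ν := ⟨htop.lt_top⟩
  have key : ∀ ε : ℝ, 0 < ε → ε ≤ 1 → c - 2 ≤ ν.real Set.univ + 3 * ε := by
    intro ε hε hε1
    obtain ⟨K, hK, hKent⟩ := exists_compact_entropy_le hε hε1
    obtain ⟨f, hf1, -, hfc, hf01⟩ := exists_continuous_one_zero_of_isCompact
      hK isClosed_empty (Set.disjoint_empty K)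
    have hbound : ∀ k, c - 2 - 3 * ε ≤ ∫ x, f x ∂(μ (φ k)) := by
      intro k
      have := hprob (φ k)
      have h1 := (hent (φ k)).trans (hKent (μ (φ k)) (hprob _) (hinv _))
      rw [EReal.coe_le_coe_iff] at h1
      have h2 : (μ (φ k)).real K ≤ ∫ x, f x ∂(μ (φ k)) := by
        rw [← integral_indicator_one hK.isClosed.measurableSet]
        refine integral_mono ((integrable_const (1 : ℝ)).indicator hK.isClosed.measurableSet)
          (f.continuous.integrable_of_hasCompactSupport hfc) fun x => ?_
        by_cases hx : x ∈ K
        · rw [Set.indicator_of_mem hx, hf1 hx]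
        · rw [Set.indicator_of_notMem hx]
          exact (hf01 x).1
      linarith
    have h3 : c - 2 - 3 * ε ≤ ∫ x, f x ∂ν :=
      ge_of_tendsto' (hlim f f.continuous hfc) hbound
    have h4 : ∫ x, f x ∂ν ≤ ν.real Set.univ := by
      calc ∫ x, f x ∂ν ≤ ∫ _x, (1 : ℝ) ∂ν :=
            integral_mono (f.continuous.integrable_of_hasCompactSupport hfc) (integrable_const _)
              fun x => (hf01 x).2
        _ = _ := by simp
    linarith
  refine ENNReal.ofReal_le_of_le_toReal (le_of_forall_pos_le_add fun ε hε => ?_)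
  have h1 := key (min (ε / 3) 1) (by positivity) (min_le_right _ _)
  have h2 := min_le_left (ε / 3) 1
  rw [measureReal_def] at h1
  linarith

end EscapeOfMass

theorem corollary1p3 (c : ℝ) (μ : ℕ → MeasureTheory.Measure EscapeOfMass.X)
    (hprob : ∀ i, MeasureTheory.IsProbabilityMeasure (μ i))
    (hinv : ∀ i, MeasureTheory.MeasurePreserving EscapeOfMass.T (μ i) (μ i))
    (hent : ∀ i, (c : EReal) ≤ EscapeOfMass.entropy EscapeOfMass.T (μ i))
    (ν : MeasureTheory.Measure EscapeOfMass.X)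
    (hν : EscapeOfMass.IsWeakStarLimit μ ν) :
    ENNReal.ofReal (c - 2) ≤ ν Set.univ := by
  exact EscapeOfMass.sub_two_le_measure_univ_of_isWeakStarLimit hprob hinv hent hν
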